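/- Conventions. For an integrable $S:\mathbb R^d\to\mathbb R$ we say that a function $C$ on $\mathbb R^d$ has spectral density $\widehat C=S$ if $C(x)=(2\pi)^{-d}\int_{\mathbb R^d}e^{-ix\cdot\xi}S(\xi)\,d\xi$ for all $x\in\mathbb R^d$. The space $C(\mathbb R^d)$ of continuous real functions carries the topology of uniform convergence on compact sets and its Borel $\sigma$-algebra. For zero-mean Gaussian fields $X_n$ on $\mathbb R^d$ (possibly on different probability spaces) and a function $C(x,y)$, "the distributions of $X_n$ converge weakly on $C(\mathbb R^d)$ to the centred Gaussian field with covariance $C$" means: every $X_n$ has a version with continuous paths; there is exactly one probability measure $P$ on $C(\mathbb R^d)$ under which the evaluations form a zero-mean Gaussian field with covariance function $C$; and for all choices of continuous versions, their laws on $C(\mathbb R^d)$ converge weakly to $P$. **Theorem.** (1) Let $X_n$ be zero-mean Gaussian random fields on $\mathbb R^d$ with stationary covariance functions $C_n(x,y)=C_n(x-y)$ having spectral densities $\widehat C_n$ with $$|\widehat C_n(\xi)|\le \frac{c}{1+|\xi|^{2s}}\qquad\text{for a.e. }\xi\in\mathbb R^d\text{ and all }n,$$ for some constants $c>0$ and $s>(d+1)/2$.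 If $\lim_{n\to\infty}C_n(x,y)=C(x,y)$ for all $x,y\in\mathbb R^d$, then the distributions of $X_n$ converge weakly on $C(\mathbb R^d)$ to the centred Gaussian field with covariance $C$. Now let $\alpha>d/2$ be non-integer, $\kappa,\sigma>0$, $a_k=\alpha(\alpha-1)\cdots(\alpha-k+1)/k!$, $p_K(t)=\sum_{k=0}^K a_k\kappa^{2(\alpha-k)}t^k$, and $K_J=\lfloor\alpha\rfloor+2J+1$ for integers $J\ge1$. Put $$C^{K}(x)=\frac{\sigma^2}{(2\pi)^d}\int_{\mathbb R^d}\frac{e^{-ix\cdot\xi}}{p_K(|\xi|^2)}\,d\xi ,\qquad C^{\mathrm{bl}}(x)=\frac{\sigma^2}{(2\pi)^d}\int_{|\xi|\le\kappa}\frac{e^{-ix\cdot\xi}}{(\kappa^2+|\xi|^2)^\alpha}\,d\xi ,$$ and for $h>0$, $j\in\mathbb Z^d$, $x\in\mathbb R^d$, $$C_{h}^{K}(hj)=\frac{\sigma^2}{(2\pi)^d}\int_{(-\pi,\pi)^d}\frac{e^{-ij\cdot\xi}}{h^d\,p_K\big(h^{-2}\sum_{p=1}^d(2-2\cos\xi_p)\big)}\,d\xi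 ,\qquad \phi^h_j(x)=\prod_{p=1}^d\frac{\sin(\pi(h^{-1}x_p-j_p))}{\pi(h^{-1}x_p-j_p)}$$ (each factor being $1$ where its denominator vanishes), $\;\widetilde C_h^{K}(x)=\sum_{j\in\mathbb Z^d}C_h^{K}(hj)\,\phi^h_j(x)$. (2) Fix $K=K_J$ with $J\ge1$. (a) For every $h>0$ the series defining $\widetilde C_h^K$ converges absolutely. If $Z$ is a zero-mean Gaussian field on the lattice $h\mathbb Z^d$ with covariance $\mathbf E Z_iZ_j=C_h^K(h(i-j))$, then the Whittaker–Shannon interpolation $X(x)=\sum_j Z_j\phi^h_j(x)$ exists for every $x$ (unconditional convergence in mean square), and it is a zero-mean Gaussian field on $\mathbb R^d$ with covariance $\widetilde C_h^K(x-y)$. (b) If $h_n>0$, $h_n\to0$, and $X^{(h_n)}$ are zero-mean Gaussian fields with covariances $\widetilde C_{h_n}^K(x-y)$ (the interpolated lattice fields), then their distributions converge weakly on $C(\mathbb R^d)$ to the centred Gaussian field with covariance $C^K(x-y)$. (3) If $X_J$, $J\ge 1$, are zero-mean Gaussian fields with covariances $C^{K_J}(x-y)$, then as $J\to\infty$ their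 distributions converge weakly on $C(\mathbb R^d)$ to the centred Gaussian field with covariance $C^{\mathrm{bl}}(x-y)$. -/

import Mathlib

open MeasureTheory ProbabilityTheory Filter Topology

noncomputable section

namespace GaussField

/-- `d`-dimensional Euclidean space. -/
abbrev E (d : ℕ) : Type := EuclideanSpace ℝ (Fin d)

/-- The Borel σ-algebra of `C(ℝ^d)`, the space of continuous real functions with the topology of
uniform convergence on compact sets (the compact-open topology). -/
instance instMeasurableSpaceC (d : ℕ) : MeasurableSpace C(E d, ℝ) := borel _

instance instBorelSpaceC (d : ℕ) : BorelSpace C(E d, ℝ) := ⟨rfl⟩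

/-- `X` is a zero mean Gaussian random field on the index set `T`, under the measure `μ`, with
covariance function `K`. Degenerate Gaussian distributions are allowed. -/
structure IsCentredGaussianField {T Ω : Type*} [MeasurableSpace Ω]
    (X : T → Ω → ℝ) (μ : Measure Ω) (K : T → T → ℝ) : Prop where
  gaussian : IsGaussianProcess X μ
  mean_eq_zero : ∀ t, ∫ ω, X t ω ∂μ = 0
  covariance_eq : ∀ s t, cov[X s, X t; μ] = K s t

/-- `Y` is a version (modification) of the random field `X` all of whose paths are continuous. -/
def IsContinuousVersion {d : ℕ} {Ω : Type*} [MeasurableSpace Ω]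
    (X : E d → Ω → ℝ) (Y : Ω → C(E d, ℝ)) (μ : Measure Ω) : Prop :=
  ∀ x, ∀ᵐ ω ∂μ, Y ω x = X x ω

/-- The distributions of the random fields `X n` converge weakly on `C(ℝ^d)` to the distribution
of the zero mean Gaussian random field with covariance function `K`:
* every `X n` has a version with continuous paths;
* there is exactly one probability measure `P` on `C(ℝ^d)` under which the evaluations form a zero
  mean Gaussian random field with covariance function `K`;
* for all choices `Y n` of continuous versions of `X n`, the `Y n` are random elements of `C(ℝ^d)`
  whose laws converge weakly to `P`. -/
def ConvergesWeaklyToGaussian {d : ℕ} {Ω : ℕ → Type*} [∀ n, MeasurableSpace (Ω n)]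
    (X : ∀ n, E d → Ω n → ℝ) (μ : ∀ n, Measure (Ω n)) [∀ n, IsProbabilityMeasure (μ n)]
    (K : E d → E d → ℝ) : Prop :=
  (∀ n, ∃ Y : Ω n → C(E d, ℝ), IsContinuousVersion (X n) Y (μ n)) ∧
  ∃ P : ProbabilityMeasure C(E d, ℝ),
    IsCentredGaussianField (fun (x : E d) (f : C(E d, ℝ)) ↦ f x) (P : Measure C(E d, ℝ)) K ∧
    (∀ Q : ProbabilityMeasure C(E d, ℝ),
      IsCentredGaussianField (fun (x : E d) (f : C(E d, ℝ)) ↦ f x) (Q : Measure C(E d, ℝ)) K →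
        Q = P) ∧
    ∀ Y : ∀ n, Ω n → C(E d, ℝ), (∀ n, IsContinuousVersion (X n) (Y n) (μ n)) →
      ∃ hY : ∀ n, AEMeasurable (Y n) (μ n),
        Tendsto (β := ProbabilityMeasure C(E d, ℝ))
          (fun n ↦ ⟨(μ n).map (Y n), Measure.isProbabilityMeasure_map (hY n)⟩) atTop (𝓝 P)

/-- The inverse Fourier transform `(2π)^{-d} ∫ exp(-i x·ξ) S(ξ) dξ`. -/
def invFourier {d : ℕ} (S : E d → ℝ) (x : E d) : ℂ :=
  ((2 * Real.pi : ℝ) ^ d : ℂ)⁻¹ *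
    ∫ ξ : E d, Complex.exp (-(Complex.I * ((inner ℝ x ξ : ℝ) : ℂ))) * (S ξ : ℂ)

/-- The stationary covariance function `C` has the spectral density `S`, that is, `S` is the
Fourier transform `Ĉ` of `C`, for the convention `Ĉ(ξ) = ∫ exp(i x·ξ) C(x) dx`. -/
def HasSpectralDensity {d : ℕ} (C : E d → ℝ) (S : E d → ℝ) : Prop :=
  Integrable S ∧ ∀ x, (C x : ℂ) = invFourier S x

/-- The binomial coefficient `a_k = α (α - 1) ⋯ (α - k + 1) / k!`. -/
def taylorCoeff (α : ℝ) (k : ℕ) : ℝ :=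
  (∏ i ∈ Finset.range k, (α - i)) / (k.factorial : ℝ)

/-- The Taylor polynomial `∑_{k=0}^K a_k κ^{2(α-k)} t^k` of `(κ² + t)^α`. -/
def taylorPoly (α κ : ℝ) (K : ℕ) (t : ℝ) : ℝ :=
  ∑ k ∈ Finset.range (K + 1), taylorCoeff α k * κ ^ (2 * (α - k)) * t ^ k

/-- The covariance function of the truncated Taylor approximation of order `K`. (Here and below
the Fourier integral is real, because the density is even.) -/
def truncatedCov {d : ℕ} (α κ σ : ℝ) (K : ℕ) (x : E d) : ℝ :=
  (invFourier (fun ξ ↦ σ ^ 2 / taylorPoly α κ K (‖ξ‖ ^ 2)) x).re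

/-- The covariance function of the band-limited fractional Matérn field. -/
def bandLimitedCov {d : ℕ} (α κ σ : ℝ) (x : E d) : ℝ :=
  (invFourier ({ξ : E d | ‖ξ‖ ≤ κ}.indicator fun ξ ↦ σ ^ 2 / (κ ^ 2 + ‖ξ‖ ^ 2) ^ α) x).re

/-- The Fourier multiplier `∑_p (2 - 2 cos ξ_p) / h²` of the finite difference operator `-Δ_h`
on functions on the lattice `h ℤ^d`. -/
def laplaceSymbol {d : ℕ} (h : ℝ) (ξ : E d) : ℝ :=
  ∑ p, (2 - 2 * Real.cos (ξ p)) / h ^ 2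

/-- The cube `(-π, π)^d`. -/
def cube (d : ℕ) : Set (E d) := {ξ | ∀ p, ξ p ∈ Set.Ioo (-Real.pi) Real.pi}

/-- A multi-index `j ∈ ℤ^d` as a vector. -/
def intVec {d : ℕ} (j : Fin d → ℤ) : E d := WithLp.toLp 2 fun p ↦ (j p : ℝ)

/-- The stationary covariance function `j ↦ C_h(h j)` of the lattice approximation on `h ℤ^d`; its
spectrum on `(-π, π)^d` is `σ² h^{-d}` times the inverse of the multiplier of
`∑_{k=0}^K a_k κ^{2(α-k)} (-Δ_h)^k`. -/
def latticeCov {d : ℕ} (α κ σ : ℝ) (K : ℕ) (h : ℝ) (j : Fin d → ℤ) : ℝ :=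
  (invFourier ((cube d).indicator fun ξ ↦
    σ ^ 2 / (h ^ d * taylorPoly α κ K (laplaceSymbol h ξ))) (intVec j)).re

/-- The Whittaker–Shannon kernel
`∏_p sin(π (x_p / h - j_p)) / (π (x_p / h - j_p))` of the lattice point `h j`. -/
def sincKernel {d : ℕ} (h : ℝ) (j : Fin d → ℤ) (x : E d) : ℝ :=
  ∏ p, Real.sinc (Real.pi * (x p / h - j p))

/-- The Whittaker–Shannon interpolation of the lattice covariance function. -/
def interpolatedCov {d : ℕ} (α κ σ : ℝ) (K : ℕ) (h : ℝ) (x : E d) : ℝ :=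
  ∑' j : Fin d → ℤ, latticeCov α κ σ K h j * sincKernel h j x

/-- `X` is the Whittaker–Shannon interpolation of the random field `Z` on the lattice `h ℤ^d`:
for each `x`, the series `∑_j Z_j sincKernel_j(x)` converges unconditionally to `X(x)` in
mean square. -/
def IsWhittakerShannonInterpolation {d : ℕ} {Ω : Type*} [MeasurableSpace Ω] (h : ℝ)
    (Z : (Fin d → ℤ) → Ω → ℝ) (X : E d → Ω → ℝ) (μ : Measure Ω) : Prop :=
  ∀ x, MemLp (X x) 2 μ ∧
    Tendsto (fun s : Finset (Fin d → ℤ) ↦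
      eLpNorm (fun ω ↦ X x ω - ∑ j ∈ s, sincKernel h j x * Z j ω) 2 μ) atTop (𝓝 0)

end GaussField

end

/-! Suppose the spectral densities are bounded by c(1+|ξ|)^(-r) with r > d+1. Since 1 - cos u ≤ |u|
costs one power of |ξ| and leaves an integrable tail, E(X(x)-X(y))² = 2(C(0)-C(x-y)) ≤ L|x-y| with L
uniform in n. Moments of Gaussian increments are powers of their variances, so Kolmogorov's chaining
over dyadic grids, with moments of order 4(d+1), yields continuous versions and moduli of continuity
controlled by L alone. By Arzelà–Ascoli the laws are tight on C(ℝ^d), and by Prokhorov they have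
cluster points. Pointwise convergence of the covariances makes every cluster point a centred
Gaussian law with the limit covariance. There is only one such law, because evaluations generate the
Borel σ-algebra. This is `convergesWeaklyToGaussian_of_increments`, and it gives the general
convergence result.

For the approximations of the Matérn field, dominated convergence of the densities replaces
convergence of the covariances (`convergesWeaklyToGaussian_of_tendsto_density`). The parity of K_J
makes the last binomial coefficient kept positive and the first one omitted negative. Hence p_K(t) ≥
(κ²+t)^α, and p_K is bounded below by a multiple of (1+t)^(⌊α⌋+3), uniformly in J ≥ 1
(`exists_le_binomPoly`). As J grows, the density tends to the Matérn density inside |ξ| < κ by the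
binomial series, and to 0 outside, where the polynomials tend to infinity. For the lattice fields,
rescaling frequencies by h makes the symbol tend to |ξ|² while staying above (4/π²)|ξ|².

The interpolation itself is linear algebra in L² of the torus. A bounded spectrum s on the cube
gives covariances ⟨e_y, M_s e_x⟩, where e_x is the exponential of frequency x and M_s is
multiplication by s. The sinc products are the Fourier coefficients of e_x, so e_x is the sum of the
e_j with these coefficients (`hasSum_torusExpLp`). Applying a continuous functional interpolates the
covariance; applying the bounded map e_j ↦ Z_j into L² of the probability space interpolates the
field. -/

namespace GaussField

/-! ### Centred Gaussian fields through their characteristic functions. -/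

section Characterization

variable {T Ω : Type*} [MeasurableSpace Ω] {X : T → Ω → ℝ} {μ : Measure Ω} {K : T → T → ℝ}

/-- The quadratic form of a kernel on finitely supported weights. -/
def quadForm (K : T → T → ℝ) (F : Finset T) (a : T → ℝ) : ℝ :=
  ∑ s ∈ F, ∑ t ∈ F, a s * a t * K s t

/-- Linear combinations of a random field. -/
def linComb {T Ω : Type*} (X : T → Ω → ℝ) (F : Finset T) (a : T → ℝ) (ω : Ω) : ℝ :=
  ∑ s ∈ F, a s * X s ω

lemma IsCentredGaussianField.hasGaussianLaw_linComb (h : IsCentredGaussianField X μ K)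
    (F : Finset T) (a : T → ℝ) : HasGaussianLaw (linComb X F a) μ :=
  (h.gaussian.smul a).hasGaussianLaw_fun_sum

lemma IsCentredGaussianField.memLp (h : IsCentredGaussianField X μ K) (t : T) :
    MemLp (X t) 2 μ :=
  (h.gaussian.hasGaussianLaw_eval t).memLp_two

lemma IsCentredGaussianField.symm (h : IsCentredGaussianField X μ K) (s t : T) :
    K s t = K t s := by
  rw [← h.covariance_eq, ← h.covariance_eq, covariance_comm]

lemma IsCentredGaussianField.integral_linComb (h : IsCentredGaussianField X μ K)
    (F : Finset T) (a : T → ℝ) : ∫ ω, linComb X F a ω ∂μ = 0 := by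
  have hi (t : T) : Integrable (X t) μ := (h.gaussian.hasGaussianLaw_eval t).integrable
  simp only [linComb]
  rw [integral_finsetSum _ fun s _ ↦ (hi s).const_mul _]
  simp [integral_const_mul, h.mean_eq_zero]

lemma IsCentredGaussianField.covariance_linComb (h : IsCentredGaussianField X μ K)
    (F G : Finset T) (a b : T → ℝ) :
    cov[linComb X F a, linComb X G b; μ] = ∑ s ∈ F, ∑ t ∈ G, a s * b t * K s t := by
  have := h.gaussian.isProbabilityMeasure
  have e (F : Finset T) (a : T → ℝ) : linComb X F a = ∑ s ∈ F, fun ω ↦ a s * X s ω := by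
    ext; simp [linComb]
  rw [e, e, covariance_sum_sum' (fun s _ ↦ (h.memLp s).const_mul _)
    (fun s _ ↦ (h.memLp s).const_mul _)]
  refine Finset.sum_congr rfl fun s _ ↦ Finset.sum_congr rfl fun t _ ↦ ?_
  rw [covariance_const_mul_left, covariance_const_mul_right, h.covariance_eq]
  ring

lemma IsCentredGaussianField.variance_linComb (h : IsCentredGaussianField X μ K)
    (F : Finset T) (a : T → ℝ) : Var[linComb X F a; μ] = quadForm K F a := by
  rw [← covariance_self (h.hasGaussianLaw_linComb F a).aemeasurable, h.covariance_linComb]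
  rfl

lemma IsCentredGaussianField.map_linComb (h : IsCentredGaussianField X μ K)
    (F : Finset T) (a : T → ℝ) :
    μ.map (linComb X F a) = gaussianReal 0 (quadForm K F a).toNNReal := by
  rw [(h.hasGaussianLaw_linComb F a).map_eq_gaussianReal, h.integral_linComb, h.variance_linComb]

lemma IsCentredGaussianField.quadForm_nonneg (h : IsCentredGaussianField X μ K)
    (F : Finset T) (a : T → ℝ) : 0 ≤ quadForm K F a := by
  rw [← h.variance_linComb]; exact variance_nonneg _ _

lemma IsCentredGaussianField.integral_cexp (h : IsCentredGaussianField X μ K)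
    (F : Finset T) (a : T → ℝ) :
    ∫ ω, Complex.exp (linComb X F a ω * Complex.I) ∂μ = Complex.exp (-(quadForm K F a : ℂ) / 2) := by
  have h1 := congrArg (fun ν ↦ charFun ν 1) (h.map_linComb F a)
  simp only [charFun_gaussianReal] at h1
  rw [charFun_apply_real,
    integral_map (h.hasGaussianLaw_linComb F a).aemeasurable (by fun_prop)] at h1
  simp only [Complex.ofReal_one, one_mul, Complex.ofReal_zero, zero_mul, one_pow, mul_one,
    zero_sub, Real.coe_toNNReal _ (h.quadForm_nonneg F a)] at h1
  rw [h1, neg_div]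

lemma quadForm_smul (K : T → T → ℝ) (F : Finset T) (a : T → ℝ) (c : ℝ) :
    quadForm K F (fun s ↦ c * a s) = c ^ 2 * quadForm K F a := by
  simp only [quadForm, Finset.mul_sum]
  exact Finset.sum_congr rfl fun s _ ↦ Finset.sum_congr rfl fun t _ ↦ by ring

lemma linComb_smul {T Ω : Type*} (X : T → Ω → ℝ) (F : Finset T) (a : T → ℝ) (c : ℝ) (ω : Ω) :
    linComb X F (fun s ↦ c * a s) ω = c * linComb X F a ω := by
  simp only [linComb, Finset.mul_sum, mul_assoc]

lemma aemeasurable_linComb (hX : ∀ t, AEMeasurable (X t) μ) (F : Finset T) (a : T → ℝ) :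
    AEMeasurable (linComb X F a) μ := by
  unfold linComb
  exact Finset.aemeasurable_fun_sum _ fun s _ ↦ (hX s).const_mul _

/-- Scaling the weights by t turns the hypothesis, which concerns frequency 1 only, into the whole
characteristic function. -/
lemma map_linComb_of_integral_cexp [IsProbabilityMeasure μ] (hX : ∀ t, AEMeasurable (X t) μ)
    {F : Finset T} {a : T → ℝ} (hq : 0 ≤ quadForm K F a)
    (hc : ∀ a, ∫ ω, Complex.exp (linComb X F a ω * Complex.I) ∂μ
      = Complex.exp (-(quadForm K F a : ℂ) / 2)) :
    μ.map (linComb X F a) = gaussianReal 0 (quadForm K F a).toNNReal := by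
  have := Measure.isProbabilityMeasure_map (aemeasurable_linComb hX F a)
  refine Measure.ext_of_charFun ?_
  ext t
  rw [charFun_apply_real, integral_map (aemeasurable_linComb hX F a) (by fun_prop),
    charFun_gaussianReal, Real.coe_toNNReal _ hq]
  have := hc fun s ↦ t * a s
  simp only [linComb_smul, quadForm_smul, Complex.ofReal_mul] at this
  rw [this]
  congr 1
  push_cast
  ring

/-- Cramér–Wold device: it reduces finite-dimensional laws to linear combinations of values of the
field. -/
lemma exists_linComb_eq {T Ω : Type*} (X : T → Ω → ℝ) (F : Finset T) (L : (F → ℝ) →L[ℝ] ℝ) :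
    ∃ a : T → ℝ, ∀ ω, L (F.restrict (X · ω)) = linComb X F a ω := by
  classical
  refine ⟨fun s ↦ if hs : s ∈ F then L (Pi.single ⟨s, hs⟩ 1) else 0, fun ω ↦ ?_⟩
  simp only [linComb]
  rw [← Finset.sum_coe_sort F]
  have : F.restrict (X · ω) = ∑ s : F, X s ω • Pi.single (M := fun _ : F ↦ ℝ) s 1 := by
    ext s
    simp [Finset.restrict, Pi.single_apply, Finset.sum_apply]
  rw [this, map_sum]
  refine Finset.sum_congr rfl fun s _ ↦ ?_
  rw [map_smul]
  simp [mul_comm]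

/-- A random field whose characteristic functions are those of a centred Gaussian field is one. -/
theorem IsCentredGaussianField.of_integral_cexp [IsProbabilityMeasure μ]
    (hX : ∀ t, AEMeasurable (X t) μ) (hK : ∀ s t, K s t = K t s)
    (hq : ∀ F a, 0 ≤ quadForm K F a)
    (hc : ∀ F a, ∫ ω, Complex.exp (linComb X F a ω * Complex.I) ∂μ
      = Complex.exp (-(quadForm K F a : ℂ) / 2)) :
    IsCentredGaussianField X μ K := by
  classical
  have hmap F a := map_linComb_of_integral_cexp hX (a := a) (hq F a) (hc F)
  have hG : IsGaussianProcess X μ := by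
    refine ⟨fun F ↦ ⟨isGaussian_of_map_eq_gaussianReal fun L ↦ ?_⟩⟩
    obtain ⟨a, ha⟩ := exists_linComb_eq X F L
    refine ⟨0, (quadForm K F a).toNNReal, ?_⟩
    rw [← hmap, AEMeasurable.map_map_of_aemeasurable (by fun_prop)
      (aemeasurable_pi_lambda (fun ω ↦ F.restrict (X · ω)) fun s ↦ hX s)]
    exact congrArg (μ.map ·) (funext ha)
  have hmean t : ∫ ω, X t ω ∂μ = 0 := by
    have h1 := hmap {t} 1
    have h2 : linComb X {t} 1 = X t := by ext; simp [linComb]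
    rw [h2] at h1
    have h3 : ∫ x, x ∂(μ.map (X t)) = 0 := by rw [h1, integral_id_gaussianReal]
    rwa [integral_map (hX t) (by fun_prop)] at h3
  -- The field is Gaussian for its own covariance. Both kernels give the same variance to every
  -- linear combination, so they agree by polarisation.
  have hL : IsCentredGaussianField X μ (fun s t ↦ cov[X s, X t; μ]) := ⟨hG, hmean, fun _ _ ↦ rfl⟩
  have hquad F a : quadForm (fun s t ↦ cov[X s, X t; μ]) F a = quadForm K F a := by
    have h1 := hL.map_linComb F a
    rw [hmap, gaussianReal_ext_iff] at h1
    exact ((Real.toNNReal_eq_toNNReal_iff (hq F a) (hL.quadForm_nonneg F a)).1 h1.2).symm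
  refine ⟨hG, hmean, fun s t ↦ ?_⟩
  have hd (t : T) : cov[X t, X t; μ] = K t t := by
    simpa [quadForm] using hquad {t} 1
  rcases eq_or_ne s t with rfl | hst
  · exact hd s
  have h2 := hquad {s, t} 1
  simp only [quadForm, Finset.sum_pair hst, Pi.one_apply, one_mul, hd, hK t s,
    covariance_comm (X t) (X s)] at h2
  linarith

end Characterization

/-! ### Stability of Gaussian fields under limits. -/

section Limits

variable {T : Type*}

lemma tendsto_quadForm {ι : Type*} {l : Filter ι} {K : ι → T → T → ℝ} {K' : T → T → ℝ}
    (h : ∀ s t, Tendsto (fun i ↦ K i s t) l (𝓝 (K' s t))) (F : Finset T) (a : T → ℝ) :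
    Tendsto (fun i ↦ quadForm (K i) F a) l (𝓝 (quadForm K' F a)) :=
  tendsto_finsetSum _ fun s _ ↦ tendsto_finsetSum _ fun t _ ↦ (h s t).const_mul _

/-- If the characteristic functions of a random field are limits of those of centred Gaussian
fields with pointwise convergent covariances, the field is centred Gaussian. -/
theorem IsCentredGaussianField.of_tendsto {ι Ω : Type*} {l : Filter ι} [l.NeBot]
    {Ω' : ι → Type*} [∀ i, MeasurableSpace (Ω' i)] [MeasurableSpace Ω]
    {Y : ∀ i, T → Ω' i → ℝ} {ν : ∀ i, Measure (Ω' i)} {K : ι → T → T → ℝ} {K' : T → T → ℝ}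
    (hY : ∀ i, IsCentredGaussianField (Y i) (ν i) (K i))
    (hK : ∀ s t, Tendsto (fun i ↦ K i s t) l (𝓝 (K' s t)))
    {X : T → Ω → ℝ} {μ : Measure Ω} [IsProbabilityMeasure μ] (hX : ∀ t, AEMeasurable (X t) μ)
    (hc : ∀ F a, Tendsto (fun i ↦ ∫ ω, Complex.exp (linComb (Y i) F a ω * Complex.I) ∂(ν i)) l
      (𝓝 (∫ ω, Complex.exp (linComb X F a ω * Complex.I) ∂μ))) :
    IsCentredGaussianField X μ K' := by
  refine .of_integral_cexp hX (fun s t ↦ ?_) (fun F a ↦ ?_) fun F a ↦ ?_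
  · exact tendsto_nhds_unique (hK s t) (by simpa only [(hY _).symm t s] using hK t s)
  · exact ge_of_tendsto' (tendsto_quadForm hK F a) fun i ↦ (hY i).quadForm_nonneg F a
  · refine tendsto_nhds_unique (hc F a) ?_
    simp only [(hY _).integral_cexp]
    exact (Complex.continuous_exp.tendsto _).comp
      (((Complex.continuous_ofReal.tendsto _).comp (tendsto_quadForm hK F a)).neg.div_const 2)

lemma norm_cexp_mul_I_sub_le (a b : ℝ) :
    ‖Complex.exp (a * Complex.I) - Complex.exp (b * Complex.I)‖ ≤ |a - b| := by
  have h : Complex.exp (a * Complex.I) - Complex.exp (b * Complex.I)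
      = Complex.exp (b * Complex.I) * (Complex.exp (Complex.I * (a - b : ℝ)) - 1) := by
    rw [mul_sub, mul_one, ← Complex.exp_add]
    congr 2
    push_cast
    ring
  rw [h, norm_mul, Complex.norm_exp_ofReal_mul_I, one_mul]
  exact Real.norm_exp_I_mul_ofReal_sub_one_le

/-- Mean square limits of centred Gaussian fields are centred Gaussian. -/
theorem IsCentredGaussianField.of_tendsto_eLpNorm {ι Ω : Type*} {l : Filter ι} [l.NeBot]
    [MeasurableSpace Ω] {μ : Measure Ω} [IsProbabilityMeasure μ]
    {Y : ι → T → Ω → ℝ} {K : ι → T → T → ℝ} {K' : T → T → ℝ}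
    (hY : ∀ i, IsCentredGaussianField (Y i) μ (K i))
    (hK : ∀ s t, Tendsto (fun i ↦ K i s t) l (𝓝 (K' s t)))
    {X : T → Ω → ℝ} (hX : ∀ t, MemLp (X t) 2 μ)
    (hc : ∀ t, Tendsto (fun i ↦ eLpNorm (X t - Y i t) 2 μ) l (𝓝 0)) :
    IsCentredGaussianField X μ K' := by
  refine .of_tendsto hY hK (fun t ↦ (hX t).aemeasurable) fun F a ↦ ?_
  -- The function exp(i·) is 1-Lipschitz, and the L¹ norm is at most the L² norm under a probability
  -- measure.
  have hb (i) : ‖(∫ ω, Complex.exp (linComb (Y i) F a ω * Complex.I) ∂μ)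
      - ∫ ω, Complex.exp (linComb X F a ω * Complex.I) ∂μ‖
      ≤ ∑ s ∈ F, |a s| * (eLpNorm (X s - Y i s) 2 μ).toReal := by
    have hi {Z : T → Ω → ℝ} (hZ : ∀ t, AEMeasurable (Z t) μ) :
        Integrable (fun ω ↦ Complex.exp (linComb Z F a ω * Complex.I)) μ := by
      have := aemeasurable_linComb hZ F a
      refine Integrable.of_bound (C := 1) (by fun_prop) (.of_forall fun ω ↦ ?_)
      rw [Complex.norm_exp_ofReal_mul_I]
    have hd (s) : MemLp (X s - Y i s) 2 μ := (hX s).sub ((hY i).memLp s)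
    rw [← integral_sub (hi fun t ↦ ((hY i).memLp t).aemeasurable)
      (hi fun t ↦ (hX t).aemeasurable)]
    calc _ ≤ ∫ ω, ∑ s ∈ F, |a s| * |X s ω - Y i s ω| ∂μ := by
          refine norm_integral_le_of_norm_le ?_ (.of_forall fun ω ↦ ?_)
          · exact integrable_finsetSum _ fun s _ ↦
              (((hd s).integrable one_le_two).abs).const_mul _
          · refine (norm_cexp_mul_I_sub_le _ _).trans ?_
            rw [linComb, linComb, ← Finset.sum_sub_distrib]
            refine (Finset.abs_sum_le_sum_abs _ _).trans (Finset.sum_le_sum fun s _ ↦ ?_)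
            rw [← mul_sub, abs_mul, abs_sub_comm]
      _ = ∑ s ∈ F, |a s| * ∫ ω, |X s ω - Y i s ω| ∂μ := by
          simp only [← integral_const_mul]
          exact integral_finsetSum _ fun s _ ↦
            (((hd s).integrable one_le_two).abs).const_mul _
      _ ≤ _ := by
          refine Finset.sum_le_sum fun s _ ↦ mul_le_mul_of_nonneg_left ?_ (abs_nonneg _)
          have h1 : ∫ ω, |X s ω - Y i s ω| ∂μ = (eLpNorm (X s - Y i s) 1 μ).toReal := by
            have := toReal_eLpNorm (p := 1) (hd s).1
            rw [eLpNorm_one_eq_lintegral_enorm,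
              ← integral_norm_eq_lintegral_enorm (hd s).1]
            rfl
          rw [h1]
          exact ENNReal.toReal_mono (hd s).2.ne
            (eLpNorm_le_eLpNorm_of_exponent_le one_le_two (hd s).1)
  rw [tendsto_iff_norm_sub_tendsto_zero]
  refine squeeze_zero (fun _ ↦ norm_nonneg _) hb ?_
  have : Tendsto (fun i ↦ ∑ s ∈ F, |a s| * (eLpNorm (X s - Y i s) 2 μ).toReal) l
      (𝓝 (∑ s ∈ F, |a s| * (0 : ENNReal).toReal)) :=
    tendsto_finsetSum _ fun s _ ↦
      ((ENNReal.tendsto_toReal ENNReal.zero_ne_top).comp (hc s)).const_mul _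
  simpa using this

end Limits

/-! ### The Borel σ-algebra of C(X, ℝ) and uniqueness of Gaussian laws. -/

section Borel

variable {X : Type*} [TopologicalSpace X] [SecondCountableTopology X] [LocallyCompactSpace X]

/-- The Borel σ-algebra of `C(X, ℝ)` is generated by the evaluations at points. -/
theorem borel_continuousMap_le :
    borel C(X, ℝ) ≤ MeasurableSpace.comap (fun (f : C(X, ℝ)) (x : X) ↦ f x) inferInstance := by
  rw [borel_eq_generateFrom_of_subbasis ContinuousMap.compactOpen_eq]
  refine MeasurableSpace.generateFrom_le ?_
  rintro _ ⟨K, hK, U, hU, rfl⟩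
  obtain ⟨D, hDc, hD⟩ := TopologicalSpace.exists_countable_dense K
  -- The closed sets A n exhaust U. The compact image f(K) keeps a positive distance from the
  -- complement of U, so it lies in a single A n, and membership in a closed set need only be tested
  -- on the countable dense set D.
  let A (n : ℕ) : Set ℝ := {y | ∀ z ∈ Uᶜ, 1 / ((n : ℝ) + 1) ≤ dist y z}
  have hA (n) : IsClosed (A n) := by
    simp only [A, Set.ofPred_forall]
    exact isClosed_biInter fun z _ ↦ isClosed_le continuous_const (by fun_prop)
  have : {f : C(X, ℝ) | Set.MapsTo f K U} = ⋃ n, ⋂ x ∈ D, {f : C(X, ℝ) | f (x : K) ∈ A n} := by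
    ext f
    simp only [Set.mem_ofPred_eq, Set.mem_iUnion, Set.mem_iInter]
    constructor
    · intro hf
      obtain ⟨δ, hδ, hsub⟩ := (hK.image f.continuous).exists_thickening_subset_open hU hf.image_subset
      obtain ⟨n, hn⟩ := exists_nat_one_div_lt hδ
      refine ⟨n, fun x _ z hz ↦ ?_⟩
      by_contra! hlt
      refine hz (hsub (Metric.mem_thickening_iff.2 ⟨f x, ⟨x, x.2, rfl⟩, ?_⟩))
      rw [dist_comm]
      exact hlt.trans hn
    · rintro ⟨n, hn⟩ x hx
      have hcl : IsClosed {x : K | f x ∈ A n} := (hA n).preimage (by fun_prop)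
      have huniv : {x : K | f x ∈ A n} = Set.univ :=
        hcl.closure_eq ▸ (hD.mono hn).closure_eq
      have hmem : f x ∈ A n := by
        have : (⟨x, hx⟩ : K) ∈ {x : K | f x ∈ A n} := huniv ▸ Set.mem_univ _
        exact this
      by_contra hU'
      have := hmem _ hU'
      rw [dist_self] at this
      exact this.not_gt (by positivity)
  beta_reduce
  rw [this]
  refine MeasurableSet.iUnion fun n ↦ MeasurableSet.biInter hDc fun x _ ↦ ?_
  exact ⟨{g | g x ∈ A n}, measurable_pi_apply (x : X) (hA n).measurableSet, rfl⟩

variable [MeasurableSpace C(X, ℝ)] [BorelSpace C(X, ℝ)]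

lemma measurableSpace_continuousMap_eq : ‹MeasurableSpace C(X, ℝ)› =
    MeasurableSpace.comap (fun (f : C(X, ℝ)) (x : X) ↦ f x) inferInstance := by
  refine le_antisymm (BorelSpace.measurable_eq.trans_le borel_continuousMap_le) ?_
  rw [← measurable_iff_comap_le]
  exact measurable_pi_lambda _ fun x ↦ (continuous_eval_const x).measurable

lemma measurable_eval_const {X : Type*} [TopologicalSpace X] [MeasurableSpace C(X, ℝ)]
    [BorelSpace C(X, ℝ)] (x : X) : Measurable fun f : C(X, ℝ) ↦ f x :=
  (continuous_eval_const x).measurable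

/-- A `C(X, ℝ)`-valued map is a random element as soon as its evaluations are random variables. -/
theorem aemeasurable_continuousMap {Ω : Type*} [MeasurableSpace Ω] {μ : Measure Ω}
    {Y : Ω → C(X, ℝ)} (hY : ∀ x, AEMeasurable (fun ω ↦ Y ω x) μ) : AEMeasurable Y μ := by
  have hn : NullMeasurable Y μ := by
    intro s hs
    obtain ⟨t, ht, rfl⟩ := (measurableSpace_continuousMap_eq (X := X)).le s hs
    -- Each evaluation is measurable for the completed σ-algebra, so the uncountably many points
    -- need no common exceptional set.
    exact @measurable_pi_lambda Ω X (fun _ ↦ ℝ)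
      (inferInstanceAs (MeasurableSpace (NullMeasurableSpace Ω μ))) _ (fun ω x ↦ Y ω x)
      (fun x ↦ (hY x).nullMeasurable) t ht
  exact hn.aemeasurable

/-- A law on `C(X, ℝ)` under which the evaluations are a centred Gaussian field is determined by
the covariance. -/
theorem IsCentredGaussianField.law_unique {P Q : Measure C(X, ℝ)} [IsProbabilityMeasure P]
    [IsProbabilityMeasure Q] {K : X → X → ℝ}
    (hP : IsCentredGaussianField (fun (x : X) (f : C(X, ℝ)) ↦ f x) P K)
    (hQ : IsCentredGaussianField (fun (x : X) (f : C(X, ℝ)) ↦ f x) Q K) : P = Q := by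
  have hm : Measurable fun (f : C(X, ℝ)) (x : X) ↦ f x :=
    measurable_pi_lambda _ measurable_eval_const
  have hlim (R : Measure C(X, ℝ)) := isProjectiveLimit_map (P := R)
    (X := fun (x : X) (f : C(X, ℝ)) ↦ f x) hm.aemeasurable
  have hmap : P.map (fun f x ↦ f x) = Q.map (fun f x ↦ f x) := by
    have h1 := hlim P
    -- Characteristic functions identify the finite-dimensional marginals, and these determine the
    -- projective limit.
    have hfin (F : Finset X) : P.map (fun f ↦ F.restrict (fun x ↦ f x))
        = Q.map (fun f ↦ F.restrict (fun x ↦ f x)) := by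
      have hmF : Measurable fun f : C(X, ℝ) ↦ F.restrict (fun x ↦ f x) :=
        measurable_pi_lambda _ fun x ↦ measurable_eval_const (x : X)
      refine Measure.ext_of_charFunDual ?_
      ext L
      obtain ⟨a, ha⟩ := exists_linComb_eq (fun (x : X) (f : C(X, ℝ)) ↦ f x) F L
      rw [charFunDual_apply, charFunDual_apply, integral_map hmF.aemeasurable (by fun_prop),
        integral_map hmF.aemeasurable (by fun_prop)]
      simp only [ha, hP.integral_cexp, hQ.integral_cexp]
    simp only [hfin] at h1
    exact h1.unique (hlim Q)
  ext s hs
  obtain ⟨t, ht, rfl⟩ := (measurableSpace_continuousMap_eq (X := X)).le s hs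
  rw [← Measure.map_apply hm ht, hmap, Measure.map_apply hm ht]

end Borel

end GaussField

namespace GaussField

/-! ### Dyadic chaining for a single function. -/

section Chaining

variable {d : ℕ}

/-- The point `2^{-m} k` of the dyadic grid. -/
noncomputable def gridPoint (m : ℕ) (k : Fin d → ℤ) : E d := WithLp.toLp 2 fun p ↦ (k p : ℝ) / 2 ^ m

/-- The index of the grid point obtained by rounding down all coordinates. -/
noncomputable def gridFloor (m : ℕ) (x : E d) : Fin d → ℤ := fun p ↦ ⌊x p * 2 ^ m⌋

/-- Grid indices of level `m` in the box `[-N, N]^d`. -/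
noncomputable def gridBox (d N m : ℕ) : Finset (Fin d → ℤ) :=
  Fintype.piFinset fun _ ↦ Finset.Icc (-(N * 2 ^ m : ℤ)) (N * 2 ^ m)

/-- Offsets between neighbouring grid indices. -/
noncomputable def gridNbhd (d : ℕ) : Finset (Fin d → ℤ) := Fintype.piFinset fun _ ↦ Finset.Icc (-1) 1

/-- The box `[-N, N]^d`. -/
def box (d N : ℕ) : Set (E d) := {x | ∀ p, |x p| ≤ N}

lemma gridFloor_mem {N : ℕ} (m : ℕ) {x : E d} (hx : x ∈ box d N) :
    gridFloor m x ∈ gridBox d N m := by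
  simp only [gridBox, Fintype.mem_piFinset, Finset.mem_Icc, gridFloor]
  intro p
  have h := abs_le.1 (hx p)
  have h2 : (0 : ℝ) < 2 ^ m := by positivity
  constructor
  · rw [Int.le_floor]
    push_cast
    nlinarith
  · have : (⌊x p * 2 ^ m⌋ : ℝ) ≤ N * 2 ^ m := (Int.floor_le _).trans (by nlinarith)
    rw [← Int.cast_le (R := ℝ)]
    push_cast
    exact this

lemma dist_gridPoint_floor_le (m : ℕ) (x : E d) (p : Fin d) :
    |gridPoint m (gridFloor m x) p - x p| ≤ 1 / 2 ^ m := by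
  have h2 : (0 : ℝ) < 2 ^ m := by positivity
  have h := Int.floor_le (x p * 2 ^ m)
  have h' := Int.lt_floor_add_one (x p * 2 ^ m)
  simp only [gridPoint, gridFloor]
  rw [abs_le, neg_le_sub_iff_le_add, sub_le_iff_le_add]
  constructor
  · rw [← add_div, le_div_iff₀ h2]; exact h'.le
  · rw [div_le_iff₀ h2, add_mul]
    have : (1 : ℝ) / 2 ^ m * 2 ^ m = 1 := by field_simp
    linarith

lemma tendsto_gridPoint_floor (x : E d) :
    Tendsto (fun m ↦ gridPoint m (gridFloor m x)) atTop (𝓝 x) := by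
  have : Tendsto (fun m p ↦ gridPoint m (gridFloor m x) p) atTop (𝓝 fun p ↦ x p) := by
    refine tendsto_pi_nhds.2 fun p ↦ ?_
    rw [tendsto_iff_norm_sub_tendsto_zero]
    refine squeeze_zero (fun _ ↦ norm_nonneg _) (fun m ↦ dist_gridPoint_floor_le m x p) ?_
    simpa using tendsto_pow_atTop_nhds_zero_of_lt_one (r := (1 / 2 : ℝ)) (by norm_num) (by norm_num)
  exact ((PiLp.continuous_toLp 2 fun _ : Fin d ↦ ℝ).tendsto _).comp this

lemma gridPoint_two_mul (m : ℕ) (k : Fin d → ℤ) :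
    gridPoint (m + 1) (fun p ↦ 2 * k p) = gridPoint m k := by
  ext p
  simp only [gridPoint]
  push_cast
  field_simp
  ring

variable {f : E d → ℝ} {δ : ℕ → ℝ} {N : ℕ}

/-- The increments of `f` between neighbouring grid points of level `m` in the box `[-N, N]^d` are
at most `δ m`. -/
def GridModulus (f : E d → ℝ) (δ : ℕ → ℝ) (N : ℕ) : Prop :=
  ∀ m, ∀ k ∈ gridBox d N m, ∀ e ∈ gridNbhd d,
    |f (gridPoint m (k + e)) - f (gridPoint m k)| ≤ δ m

/-- Since ⌊2u⌋ - 2⌊u⌋ is 0 or 1, consecutive dyadic roundings of x are neighbours on the finer grid.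
-/
lemma GridModulus.dist_succ_le (hf : GridModulus f δ N) {x : E d} (hx : x ∈ box d N) (m : ℕ) :
    dist (f (gridPoint m (gridFloor m x))) (f (gridPoint (m + 1) (gridFloor (m + 1) x)))
      ≤ δ (m + 1) := by
  rw [dist_comm, Real.dist_eq, ← gridPoint_two_mul m]
  have hk : (fun p ↦ 2 * gridFloor m x p) ∈ gridBox d N (m + 1) := by
    have := gridFloor_mem m hx
    simp only [gridBox, Fintype.mem_piFinset, Finset.mem_Icc] at this ⊢
    intro p
    have := this p
    rw [pow_succ]
    constructor <;> linarith
  have he : gridFloor (m + 1) x - (fun p ↦ 2 * gridFloor m x p) ∈ gridNbhd d := by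
    simp only [gridNbhd, Fintype.mem_piFinset, Finset.mem_Icc, Pi.sub_apply, gridFloor]
    intro p
    have h1 := Int.floor_le (x p * 2 ^ m)
    have h2 := Int.lt_floor_add_one (x p * 2 ^ m)
    have h3 : 2 * ⌊x p * 2 ^ m⌋ ≤ ⌊x p * 2 ^ (m + 1)⌋ := by
      rw [Int.le_floor]; push_cast; rw [pow_succ]; linarith
    have h4 : ⌊x p * 2 ^ (m + 1)⌋ < 2 * ⌊x p * 2 ^ m⌋ + 2 := by
      rw [Int.floor_lt]; push_cast; rw [pow_succ]; linarith
    constructor <;> linarith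
  simpa using hf (m + 1) _ hk _ he

/-- Scaled coordinates that differ by at most 1 have floors that differ by at most 1. -/
lemma GridModulus.abs_sub_le (hf : GridModulus f δ N) {x y : E d} (hx : x ∈ box d N) (m : ℕ)
    (hxy : ∀ p, |x p - y p| ≤ 1 / 2 ^ m) :
    |f (gridPoint m (gridFloor m x)) - f (gridPoint m (gridFloor m y))| ≤ δ m := by
  have he : gridFloor m y - gridFloor m x ∈ gridNbhd d := by
    simp only [gridNbhd, Fintype.mem_piFinset, Finset.mem_Icc, Pi.sub_apply, gridFloor]
    intro p
    have h2 : (0 : ℝ) < 2 ^ m := by positivity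
    have h := abs_le.1 (hxy p)
    have e : (1 : ℝ) / 2 ^ m * 2 ^ m = 1 := by field_simp
    have ha : x p * 2 ^ m ≤ y p * 2 ^ m + 1 := by nlinarith
    have hb : y p * 2 ^ m ≤ x p * 2 ^ m + 1 := by nlinarith
    have h3 := Int.floor_le_floor ha
    have h4 := Int.floor_le_floor hb
    rw [Int.floor_add_one] at h3 h4
    constructor <;> linarith
  rw [abs_sub_comm]
  simpa using hf m _ (gridFloor_mem m hx) _ he

lemma GridModulus.exists_tendsto (hf : GridModulus f δ N) (hδ : Summable δ) {x : E d}
    (hx : x ∈ box d N) :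
    ∃ a, Tendsto (fun m ↦ f (gridPoint m (gridFloor m x))) atTop (𝓝 a) :=
  cauchySeq_tendsto_of_complete
    (cauchySeq_of_dist_le_of_summable _ (hf.dist_succ_le hx) ((summable_nat_add_iff 1).2 hδ))

/-- Modulus of continuity of the limit along the dyadic grid. -/
lemma GridModulus.abs_limit_sub_le (hf : GridModulus f δ N) (hδ : Summable δ) {x y : E d}
    (hx : x ∈ box d N) (hy : y ∈ box d N) {m : ℕ} (hxy : ∀ p, |x p - y p| ≤ 1 / 2 ^ m) {a b : ℝ}
    (ha : Tendsto (fun m ↦ f (gridPoint m (gridFloor m x))) atTop (𝓝 a))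
    (hb : Tendsto (fun m ↦ f (gridPoint m (gridFloor m y))) atTop (𝓝 b)) :
    |a - b| ≤ δ m + 2 * ∑' j, δ (m + j + 1) := by
  have hs := (summable_nat_add_iff 1).2 hδ
  have h1 := dist_le_tsum_of_dist_le_of_tendsto _ (hf.dist_succ_le hx) hs ha m
  have h2 := dist_le_tsum_of_dist_le_of_tendsto _ (hf.dist_succ_le hy) hs hb m
  have h3 := hf.abs_sub_le hx m hxy
  rw [Real.dist_eq] at h1 h2
  rw [abs_le] at *
  constructor <;> linarith

end Chaining

/-! ### Arzelà–Ascoli for prescribed moduli of continuity. -/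

section Compactness

variable {d : ℕ}

/-- Functions with prescribed bounds at the origin and moduli of continuity on the boxes
`[-N, N]^d`. -/
def HasModulus (R₀ : ℝ) (ω : ℕ → ℕ → ℝ) (g : E d → ℝ) : Prop :=
  |g 0| ≤ R₀ ∧ ∀ N m, ∀ x ∈ box d N, ∀ y ∈ box d N, (∀ p, |x p - y p| ≤ 1 / 2 ^ m) →
    |g x - g y| ≤ ω N m

variable {R₀ : ℝ} {ω : ℕ → ℕ → ℝ}

lemma exists_mem_box (x : E d) : ∃ N : ℕ, ∀ y ∈ Metric.closedBall x 1, y ∈ box d N := by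
  obtain ⟨N, hN⟩ := exists_nat_ge (‖x‖ + 1)
  refine ⟨N, fun y hy p ↦ ?_⟩
  have h1 : ‖y p‖ ≤ ‖y‖ := PiLp.norm_apply_le y p
  have h2 : ‖y‖ ≤ ‖x‖ + 1 := by
    have := norm_le_norm_add_norm_sub' y x
    rw [Metric.mem_closedBall, dist_eq_norm] at hy
    linarith
  rw [← Real.norm_eq_abs]
  linarith

lemma equicontinuousAt_of_modulus {τ : ℕ → ℝ} (hτ : Tendsto τ atTop (𝓝 0)) {ι : Type*} {G : ι → E d → ℝ}
    {x : E d} {N : ℕ} (hN : ∀ y ∈ Metric.closedBall x 1, y ∈ box d N)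
    (hG : ∀ i m, ∀ y ∈ box d N, (∀ p, |x p - y p| ≤ 1 / 2 ^ m) → |G i x - G i y| ≤ τ m) :
    EquicontinuousAt G x := by
  rw [Metric.equicontinuousAt_iff]
  intro ε hε
  obtain ⟨m, hm⟩ := (hτ.eventually_lt_const hε).exists
  refine ⟨min 1 (1 / 2 ^ m), by positivity, fun y hy i ↦ ?_⟩
  rw [lt_min_iff] at hy
  refine lt_of_le_of_lt ?_ hm
  rw [Real.dist_eq]
  refine hG i m y (hN y hy.1.le) fun p ↦ ?_
  have h1 : ‖(x - y) p‖ ≤ ‖x - y‖ := PiLp.norm_apply_le _ p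
  rw [dist_comm, dist_eq_norm] at hy
  exact h1.trans hy.2.le

lemma equicontinuous_of_hasModulus (hω : ∀ N, Tendsto (ω N) atTop (𝓝 0)) {ι : Type*}
    {G : ι → E d → ℝ} (hG : ∀ i, HasModulus R₀ ω (G i)) : Equicontinuous G := by
  intro x
  obtain ⟨N, hN⟩ := exists_mem_box x
  exact equicontinuousAt_of_modulus (hω N) hN fun i m y hy ↦
    (hG i).2 N m x (hN x (Metric.mem_closedBall_self zero_le_one)) y hy

/-- The segment from 0 to x is cut into N + 1 pieces, each moving every coordinate by at most
N/(N+1) ≤ 1, the scale m = 0. -/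
lemma HasModulus.abs_le {g : E d → ℝ} (hg : HasModulus R₀ ω g) {x : E d} {N : ℕ}
    (hx : x ∈ box d N) : |g x| ≤ R₀ + (N + 1) * ω N 0 := by
  let y (i : ℕ) : E d := ((i : ℝ) / (N + 1)) • x
  have hN : (0 : ℝ) < N + 1 := by positivity
  have hy (i : ℕ) (hi : i ≤ N + 1) : y i ∈ box d N := by
    intro p
    have h1 : |(i : ℝ) / (N + 1)| ≤ 1 := by
      rw [abs_of_nonneg (by positivity), div_le_one hN]
      exact_mod_cast hi
    simp only [y, PiLp.smul_apply, smul_eq_mul, abs_mul]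
    exact (mul_le_of_le_one_left (abs_nonneg _) h1).trans (hx p)
  have hstep (i : ℕ) (hi : i < N + 1) : |g (y (i + 1)) - g (y i)| ≤ ω N 0 := by
    refine hg.2 N 0 _ (hy _ hi) _ (hy _ hi.le) fun p ↦ ?_
    have h2 : y (i + 1) p - y i p = x p / (N + 1) := by
      simp only [y, PiLp.smul_apply, smul_eq_mul]
      push_cast
      ring
    rw [h2, abs_div, abs_of_pos hN, pow_zero, div_one, div_le_one hN]
    linarith [hx p]
  have hsum : g x - g 0 = ∑ i ∈ Finset.range (N + 1), (g (y (i + 1)) - g (y i)) := by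
    rw [Finset.sum_range_sub (fun i ↦ g (y i))]
    simp only [y]
    push_cast
    rw [div_self hN.ne', one_smul, zero_div, zero_smul]
  have h3 : |g x - g 0| ≤ (N + 1) * ω N 0 := by
    rw [hsum]
    refine (Finset.abs_sum_le_sum_abs _ _).trans ?_
    refine (Finset.sum_le_sum fun i hi ↦ hstep i (Finset.mem_range.1 hi)).trans ?_
    simp
  have h4 := abs_sub_abs_le_abs_sub (g x) (g 0)
  linarith [hg.1]

/-- The continuous functions satisfying given moduli of continuity form a compact set. -/
theorem isCompact_setOf_hasModulus (hω : ∀ N, Tendsto (ω N) atTop (𝓝 0)) :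
    IsCompact {f : C(E d, ℝ) | HasModulus R₀ ω f} := by
  refine ArzelaAscoli.isCompact_of_equicontinuous _ ?_
    (equicontinuous_of_hasModulus hω fun f : {f : C(E d, ℝ) | HasModulus R₀ ω f} ↦ f.2)
  -- The moduli alone force continuity, so the image among all functions is cut out by pointwise
  -- closed conditions. Being also contained in a product of intervals, it is compact by Tychonoff.
  have himage : ContinuousMap.toFun '' {f : C(E d, ℝ) | HasModulus R₀ ω f}
      = {g | HasModulus R₀ ω g} := by
    ext g
    constructor
    · rintro ⟨f, hf, rfl⟩
      exact hf
    · intro hg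
      have : Continuous g := continuous_iff_continuousAt.2 fun x ↦
        (equicontinuous_of_hasModulus hω (fun _ : Unit ↦ hg) x).continuousAt ()
      exact ⟨⟨g, this⟩, hg, rfl⟩
  rw [himage]
  choose N hN using exists_mem_box (d := d)
  refine IsCompact.of_isClosed_subset (isCompact_univ_pi fun x ↦
    isCompact_Icc (a := -(R₀ + ((N x : ℝ) + 1) * ω (N x) 0)) (b := R₀ + (N x + 1) * ω (N x) 0))
    ?_ fun g hg x _ ↦ ?_
  · simp only [HasModulus, Set.ofPred_and, Set.ofPred_forall]
    refine (isClosed_le (by fun_prop) (by fun_prop)).inter ?_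
    refine isClosed_iInter fun N ↦ isClosed_iInter fun m ↦ isClosed_iInter fun x ↦
      isClosed_iInter fun _ ↦ isClosed_iInter fun y ↦ isClosed_iInter fun _ ↦
      isClosed_iInter fun _ ↦ isClosed_le (by fun_prop) (by fun_prop)
  · exact abs_le.1 (HasModulus.abs_le hg (hN x x (Metric.mem_closedBall_self zero_le_one)))

end Compactness

end GaussField

namespace GaussField

/-! ### Moments of Gaussian increments. -/

section Moments

open scoped ENNReal NNReal

/-- Absolute moments of the standard Gaussian distribution. -/
noncomputable def stdMoment (q : ℕ) : ℝ≥0∞ := ∫⁻ z, ‖z‖ₑ ^ q ∂(gaussianReal 0 1)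

lemma stdMoment_lt_top (q : ℕ) : stdMoment q < ∞ := by
  rcases eq_or_ne q 0 with rfl | hq
  · simp [stdMoment]
  have h := memLp_id_gaussianReal (μ := 0) (v := 1) q
  have := lintegral_rpow_enorm_lt_top_of_eLpNorm_lt_top (by simpa using hq) (by simp) h.2
  simpa [stdMoment] using this

/-- A centred Gaussian of variance v is √v times a standard one. -/
lemma lintegral_enorm_pow_gaussianReal (v : ℝ≥0) (q : ℕ) :
    ∫⁻ z, ‖z‖ₑ ^ (2 * q) ∂(gaussianReal 0 v) = (v : ℝ≥0∞) ^ q * stdMoment (2 * q) := by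
  have h : gaussianReal 0 v = (gaussianReal 0 1).map (√(v : ℝ) * ·) := by
    rw [gaussianReal_map_const_mul]
    congr 1
    · simp
    · ext; simp
  rw [h, lintegral_map (by fun_prop) (by fun_prop), stdMoment, ← lintegral_const_mul _ (by fun_prop)]
  congr 1
  ext z
  rw [enorm_mul, mul_pow, pow_mul, ← enorm_pow, Real.sq_sqrt v.coe_nonneg]
  simp

variable {T Ω : Type*} [MeasurableSpace Ω] {X : T → Ω → ℝ} {μ : Measure Ω} {K : T → T → ℝ}

lemma IsCentredGaussianField.map_sub (h : IsCentredGaussianField X μ K) (s t : T) :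
    μ.map (X s - X t) = gaussianReal 0 (K s s + K t t - 2 * K s t).toNNReal := by
  have := h.gaussian.isProbabilityMeasure
  rw [h.gaussian.hasGaussianLaw_sub.map_eq_gaussianReal]
  congr 1
  · have hi (t : T) : Integrable (X t) μ := (h.gaussian.hasGaussianLaw_eval t).integrable
    simp only [Pi.sub_apply]
    rw [integral_sub (hi s) (hi t), h.mean_eq_zero, h.mean_eq_zero, sub_zero]
  · rw [variance_sub (h.memLp s) (h.memLp t), ← covariance_self (h.gaussian.aemeasurable s),
      ← covariance_self (h.gaussian.aemeasurable t), h.covariance_eq, h.covariance_eq,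
      h.covariance_eq]
    congr 1
    ring

lemma IsCentredGaussianField.lintegral_enorm_sub_pow (h : IsCentredGaussianField X μ K) (q : ℕ)
    (s t : T) : ∫⁻ ω, ‖X s ω - X t ω‖ₑ ^ (2 * q) ∂μ
      = ENNReal.ofReal (K s s + K t t - 2 * K s t) ^ q * stdMoment (2 * q) := by
  have h1 := lintegral_enorm_pow_gaussianReal (K s s + K t t - 2 * K s t).toNNReal q
  rw [← h.map_sub, lintegral_map' (by fun_prop)
    ((h.gaussian.aemeasurable s).sub (h.gaussian.aemeasurable t))] at h1
  exact h1

lemma IsCentredGaussianField.measure_abs_gt_le (h : IsCentredGaussianField X μ K) (t : T)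
    {R : ℝ} (hR : 0 < R) : μ {ω | R < |X t ω|} ≤ ENNReal.ofReal (K t t / R ^ 2) := by
  have := h.gaussian.isProbabilityMeasure
  have h1 := meas_ge_le_variance_div_sq (h.memLp t) hR
  rw [h.mean_eq_zero, ← covariance_self (h.gaussian.aemeasurable t), h.covariance_eq] at h1
  refine (measure_mono fun ω hω ↦ ?_).trans h1
  simpa using (le_of_lt hω : R ≤ |X t ω|)

end Moments

/-! ### Expected size of the increments over all dyadic grids. -/

section Increments

open scoped ENNReal NNReal

variable {d : ℕ}

/-- The ratio of the geometric sequence bounding the increments on the dyadic grids. -/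
noncomputable def chainRatio : ℝ := (1 / 2 : ℝ) ^ (1 / 4 : ℝ)

lemma chainRatio_pos : 0 < chainRatio := Real.rpow_pos_of_pos (by norm_num) _

lemma chainRatio_lt_one : chainRatio < 1 :=
  Real.rpow_lt_one (by norm_num) (by norm_num) (by norm_num)

/-- The fourth root makes the weights of order 4(d+1) grow like 2^(m(d+1)), half the exponent at
which the Gaussian moments decay. -/
lemma chainRatio_pow_four : chainRatio ^ 4 = 1 / 2 := by
  rw [chainRatio, ← Real.rpow_natCast, ← Real.rpow_mul (by norm_num)]
  norm_num

/-- The weighted sum of the powers of the increments of `f` over the dyadic grids in a box. -/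
noncomputable def incrementSum (d N : ℕ) (f : E d → ℝ) : ℝ≥0∞ :=
  ∑' m, ∑ k ∈ gridBox d N m, ∑ e ∈ gridNbhd d,
    ‖(chainRatio ^ m)⁻¹ * (f (gridPoint m (k + e)) - f (gridPoint m k))‖ₑ ^ (2 * (2 * (d + 1)))

lemma gridModulus_of_incrementSum_le {N : ℕ} {f : E d → ℝ} {R : ℝ} (hR : 0 ≤ R)
    (hf : incrementSum d N f ≤ ENNReal.ofReal R) :
    GridModulus f (fun m ↦ (1 + R) * chainRatio ^ m) N := by
  intro m k hk e he
  have hρ := pow_pos chainRatio_pos m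
  set D := f (gridPoint m (k + e)) - f (gridPoint m k)
  have h1 : ‖(chainRatio ^ m)⁻¹ * D‖ₑ ^ (2 * (2 * (d + 1))) ≤ ENNReal.ofReal R := by
    refine le_trans ?_ hf
    refine le_trans ?_ (ENNReal.le_tsum m)
    refine le_trans ?_ (Finset.single_le_sum_of_canonicallyOrdered hk)
    exact Finset.single_le_sum_of_canonicallyOrdered (f := fun e ↦ ‖(chainRatio ^ m)⁻¹ *
      (f (gridPoint m (k + e)) - f (gridPoint m k))‖ₑ ^ (2 * (2 * (d + 1)))) he
  rw [← ofReal_norm, ← ENNReal.ofReal_pow (norm_nonneg _),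
    ENNReal.ofReal_le_ofReal_iff hR] at h1
  -- Bounding by 1 + R avoids extracting a root of R of order 4(d+1).
  have h2 : R ≤ (1 + R) ^ (2 * (2 * (d + 1))) :=
    calc R ≤ 1 + R := by linarith
      _ ≤ _ := le_self_pow₀ (by linarith) (by simp)
  have h3 := le_of_pow_le_pow_left₀ (by simp) (by linarith) (h1.trans h2)
  rw [norm_mul, norm_inv, Real.norm_of_nonneg hρ.le, inv_mul_le_iff₀ hρ, mul_comm] at h3
  exact h3

lemma norm_gridPoint_sub_le (m : ℕ) (k e : Fin d → ℤ) (he : e ∈ gridNbhd d) :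
    ‖gridPoint m (k + e) - gridPoint m k‖ ≤ d / 2 ^ m := by
  have h1 (x : E d) : ‖x‖ ≤ ∑ p, |x p| := by
    rw [EuclideanSpace.norm_eq]
    refine Real.sqrt_le_iff.2 ⟨by positivity, ?_⟩
    exact Finset.sum_sq_le_sq_sum_of_nonneg fun p _ ↦ abs_nonneg _
  refine (h1 _).trans ?_
  calc _ ≤ ∑ p : Fin d, (1 : ℝ) / 2 ^ m := by
        refine Finset.sum_le_sum fun p _ ↦ ?_
        simp only [gridNbhd, Fintype.mem_piFinset, Finset.mem_Icc] at he
        simp only [gridPoint, PiLp.sub_apply, Pi.add_apply]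
        rw [← sub_div, abs_div, abs_of_pos (by positivity : (0 : ℝ) < 2 ^ m)]
        gcongr
        have := abs_le.2 (he p)
        push_cast
        rw [add_sub_cancel_left]
        exact_mod_cast this
    _ = _ := by simp; ring

lemma card_gridBox (N m : ℕ) : (gridBox d N m).card ≤ ((2 * N + 1) * 2 ^ m) ^ d := by
  rw [gridBox, Fintype.card_piFinset]
  simp only [Int.card_Icc, Finset.prod_const, Finset.card_univ, Fintype.card_fin]
  refine Nat.pow_le_pow_left ?_ d
  have : 1 ≤ 2 ^ m := Nat.one_le_two_pow
  rw [Int.toNat_le]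
  push_cast
  have : (1 : ℤ) ≤ 2 ^ m := by exact_mod_cast this
  linarith

/-- A variance of at most L·d·2^(-m) gives a moment of order 4(d+1) of size 2^(-2m(d+1)); the weight
gives back 2^(m(d+1)). -/
lemma lintegral_increment_le {L : ℝ} (hL : 0 ≤ L) {Ω : Type*} [MeasurableSpace Ω]
    {μ : Measure Ω} {X : E d → Ω → ℝ} {K : E d → E d → ℝ} (h : IsCentredGaussianField X μ K)
    (hK : ∀ x y, K x x + K y y - 2 * K x y ≤ L * ‖x - y‖) (m : ℕ) (k : Fin d → ℤ)
    {e : Fin d → ℤ} (he : e ∈ gridNbhd d) :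
    ∫⁻ ω, ‖(chainRatio ^ m)⁻¹ * (X (gridPoint m (k + e)) ω - X (gridPoint m k) ω)‖ₑ
        ^ (2 * (2 * (d + 1))) ∂μ
      ≤ ENNReal.ofReal ((L * d) ^ (2 * (d + 1)) * (1 / 2 ^ m) ^ (d + 1))
        * stdMoment (2 * (2 * (d + 1))) := by
  simp only [enorm_mul, mul_pow]
  rw [lintegral_const_mul' _ _ (by simp), h.lintegral_enorm_sub_pow, ← mul_assoc,
    ← ofReal_norm, ← ENNReal.ofReal_pow (norm_nonneg _)]
  gcongr
  have h1 : K (gridPoint m (k + e)) (gridPoint m (k + e)) + K (gridPoint m k) (gridPoint m k)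
      - 2 * K (gridPoint m (k + e)) (gridPoint m k) ≤ L * d * (1 / 2 ^ m) := by
    refine (hK _ _).trans ?_
    rw [mul_assoc, mul_one_div]
    exact mul_le_mul_of_nonneg_left (norm_gridPoint_sub_le m k e he) hL
  refine (mul_le_mul_right (pow_le_pow_left₀ (by simp) (ENNReal.ofReal_le_ofReal h1) _) _).trans ?_
  rw [← ENNReal.ofReal_pow (by positivity), ← ENNReal.ofReal_mul (by positivity)]
  refine ENNReal.ofReal_le_ofReal (le_of_eq ?_)
  have hρ : ‖(chainRatio ^ m)⁻¹‖ ^ (2 * (2 * (d + 1))) = (2 ^ m) ^ (d + 1) := by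
    rw [norm_inv, Real.norm_of_nonneg (pow_pos chainRatio_pos m).le, inv_pow, ← pow_mul,
      show m * (2 * (2 * (d + 1))) = 4 * (m * (d + 1)) by ring, pow_mul, chainRatio_pow_four,
      ← pow_mul, one_div, inv_pow, inv_inv]
  rw [hρ, mul_pow (L * d), mul_pow L, show 2 * (d + 1) = (d + 1) + (d + 1) by ring,
    pow_add (1 / 2 ^ m : ℝ)]
  have : (2 ^ m : ℝ) ^ (d + 1) * (1 / 2 ^ m) ^ (d + 1) = 1 := by
    rw [← mul_pow, mul_one_div_cancel (by positivity), one_pow]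
  linear_combination (L ^ (d + 1 + (d + 1)) * (d : ℝ) ^ (d + 1 + (d + 1))
    * (1 / 2 ^ m) ^ (d + 1)) * this

/-- Level m has of the order of 2^(md) increments with weighted moments of size 2^(-m(d+1)), so the
levels sum like 2^(-m). That C does not depend on the field is what uniform tightness needs. -/
lemma exists_lintegral_incrementSum_le (d N : ℕ) {L : ℝ} (hL : 0 ≤ L) :
    ∃ C : ℝ≥0, ∀ {Ω : Type*} [MeasurableSpace Ω] {μ : Measure Ω} {X : E d → Ω → ℝ}
      {K : E d → E d → ℝ}, IsCentredGaussianField X μ K →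
      (∀ x y, K x x + K y y - 2 * K x y ≤ L * ‖x - y‖) →
      ∫⁻ ω, incrementSum d N (X · ω) ∂μ ≤ C := by
  set M := stdMoment (2 * (2 * (d + 1))) with hM
  set B : ℝ := (2 * N + 1) ^ d * (gridNbhd d).card * (L * d) ^ (2 * (d + 1)) with hB
  have hfin : ∑' m : ℕ, ENNReal.ofReal (B * (1 / 2) ^ m) * M ≠ ∞ := by
    rw [ENNReal.tsum_mul_right]
    refine ENNReal.mul_ne_top ?_ (stdMoment_lt_top _).ne
    rw [← ENNReal.ofReal_tsum_of_nonneg (fun m ↦ by positivity)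
      (summable_geometric_two.mul_left B)]
    exact ENNReal.ofReal_ne_top
  refine ⟨(∑' m : ℕ, ENNReal.ofReal (B * (1 / 2) ^ m) * M).toNNReal, fun {Ω} _ μ X K h hK ↦ ?_⟩
  rw [ENNReal.coe_toNNReal hfin]
  have hX (x : E d) := h.gaussian.aemeasurable x
  unfold incrementSum
  have hm (m : ℕ) (k e : Fin d → ℤ) : AEMeasurable (fun ω ↦ ‖(chainRatio ^ m)⁻¹ *
      (X (gridPoint m (k + e)) ω - X (gridPoint m k) ω)‖ₑ ^ (2 * (2 * (d + 1)))) μ := by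
    have := hX (gridPoint m (k + e))
    have := hX (gridPoint m k)
    fun_prop
  rw [lintegral_tsum fun m ↦ Finset.aemeasurable_fun_sum _ fun k _ ↦
    Finset.aemeasurable_fun_sum _ fun e _ ↦ hm m k e]
  refine ENNReal.tsum_le_tsum fun m ↦ ?_
  rw [lintegral_finsetSum' _ fun k _ ↦ Finset.aemeasurable_fun_sum _ fun e _ ↦ hm m k e]
  set V := ENNReal.ofReal ((L * d) ^ (2 * (d + 1)) * (1 / 2 ^ m) ^ (d + 1)) * M
  calc _ ≤ ∑ k ∈ gridBox d N m, ∑ e ∈ gridNbhd d, V := by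
        refine Finset.sum_le_sum fun k _ ↦ ?_
        rw [lintegral_finsetSum' _ fun e _ ↦ hm m k e]
        exact Finset.sum_le_sum fun e he ↦ lintegral_increment_le hL h hK m k he
    _ = ((gridBox d N m).card : ℝ≥0∞) * (gridNbhd d).card * V := by
        simp [mul_assoc]
    _ ≤ ((((2 * N + 1) * 2 ^ m) ^ d : ℕ) : ℝ≥0∞) * (gridNbhd d).card * V := by
        gcongr
        exact card_gridBox N m
    _ = _ := by
        rw [← mul_assoc, ← ENNReal.ofReal_natCast, ← ENNReal.ofReal_natCast,
          ← ENNReal.ofReal_mul (by positivity), ← ENNReal.ofReal_mul (by positivity)]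
        congr 2
        push_cast
        rw [mul_pow, pow_succ (1 / 2 ^ m : ℝ), one_div_pow 2 m, hB]
        have : (2 ^ m : ℝ) ^ d * (1 / 2 ^ m) ^ d = 1 := by
          rw [← mul_pow, mul_one_div_cancel (by positivity), one_pow]
        linear_combination ((2 * N + 1) ^ d * (gridNbhd d).card * (L * d) ^ (2 * (d + 1))
          * (1 / 2 ^ m : ℝ)) * this

end Increments

/-! ### Continuous versions and uniform tightness. -/

section Versions

open scoped ENNReal NNReal

variable {d : ℕ} {Ω : Type*} [MeasurableSpace Ω] {μ : Measure Ω} {X : E d → Ω → ℝ}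
  {K : E d → E d → ℝ} {L : ℝ}

lemma summable_chain (R : ℝ) : Summable fun m ↦ (1 + R) * chainRatio ^ m :=
  (summable_geometric_of_lt_one chainRatio_pos.le chainRatio_lt_one).mul_left _

/-- The modulus of continuity obtained from a bound `R` on the sums of increments. -/
noncomputable def chainModulus (R : ℝ) (m : ℕ) : ℝ :=
  (1 + R) * chainRatio ^ m + 2 * ∑' j, (1 + R) * chainRatio ^ (m + j + 1)

lemma tendsto_chainModulus (R : ℝ) : Tendsto (chainModulus R) atTop (𝓝 0) := by
  have h1 := (summable_chain R).tendsto_atTop_zero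
  have h2 := (tendsto_sum_nat_add fun m ↦ (1 + R) * chainRatio ^ m).comp (tendsto_add_atTop_nat 1)
  have h3 := h1.add (h2.const_mul 2)
  rw [mul_zero, add_zero] at h3
  refine h3.congr fun m ↦ ?_
  simp only [chainModulus, Function.comp_apply]
  congr 3
  ext j
  congr 2
  ring

/-- A finite sum of increments in every box yields a continuous limit along the dyadic grids. -/
lemma exists_continuousMap_of_incrementSum {f : E d → ℝ}
    (hf : ∀ N, incrementSum d N f < ∞) :
    ∃ g : C(E d, ℝ), ∀ x, Tendsto (fun m ↦ f (gridPoint m (gridFloor m x))) atTop (𝓝 (g x)) := by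
  have hmod (N : ℕ) : GridModulus f
      (fun m ↦ (1 + (incrementSum d N f).toReal) * chainRatio ^ m) N :=
    gridModulus_of_incrementSum_le ENNReal.toReal_nonneg
      (by rw [ENNReal.ofReal_toReal (hf N).ne])
  have hlim (x : E d) : ∃ a, Tendsto (fun m ↦ f (gridPoint m (gridFloor m x))) atTop (𝓝 a) := by
    obtain ⟨N, hN⟩ := exists_mem_box x
    exact (hmod N).exists_tendsto (summable_chain _)
      (hN x (Metric.mem_closedBall_self zero_le_one))
  choose g hg using hlim
  have hcont : Continuous g := by
    refine continuous_iff_continuousAt.2 fun x ↦ ?_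
    obtain ⟨N, hN⟩ := exists_mem_box x
    refine (equicontinuousAt_of_modulus (G := fun _ : Unit ↦ g)
      (tendsto_chainModulus (incrementSum d N f).toReal) hN fun _ m y hy hxy ↦ ?_).continuousAt ()
    exact (hmod N).abs_limit_sub_le (summable_chain _)
      (hN x (Metric.mem_closedBall_self zero_le_one)) hy hxy (hg x) (hg y)
  exact ⟨⟨g, hcont⟩, hg⟩

/-- A centred Gaussian field with mean square increments bounded by the distance has a continuous
version. -/
theorem IsCentredGaussianField.exists_continuousVersion (h : IsCentredGaussianField X μ K)
    (hL : 0 ≤ L) (hK : ∀ x y, K x x + K y y - 2 * K x y ≤ L * ‖x - y‖) :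
    ∃ Y : Ω → C(E d, ℝ), IsContinuousVersion X Y μ := by
  classical
  have := h.gaussian.isProbabilityMeasure
  have hX (x : E d) := h.gaussian.aemeasurable x
  have hfin : ∀ᵐ ω ∂μ, ∀ N, incrementSum d N (X · ω) < ∞ := by
    refine ae_all_iff.2 fun N ↦ ?_
    obtain ⟨C, hC⟩ := exists_lintegral_incrementSum_le d N hL
    refine ae_lt_top' ?_ ((hC h hK).trans_lt ENNReal.coe_lt_top).ne
    unfold incrementSum
    refine AEMeasurable.tsum fun m ↦ Finset.aemeasurable_fun_sum _ fun k _ ↦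
      Finset.aemeasurable_fun_sum _ fun e _ ↦ ?_
    have := hX (gridPoint m (k + e))
    have := hX (gridPoint m k)
    fun_prop
  -- Outside an almost sure event the limit along the grids may fail to be a continuous function;
  -- the path is then set to 0.
  let Y (ω : Ω) : C(E d, ℝ) := if hω : ∃ g : C(E d, ℝ), ∀ x,
    Tendsto (fun m ↦ X (gridPoint m (gridFloor m x)) ω) atTop (𝓝 (g x)) then hω.choose else 0
  refine ⟨Y, fun x ↦ ?_⟩
  have hY : ∀ᵐ ω ∂μ, Tendsto (fun m ↦ X (gridPoint m (gridFloor m x)) ω) atTop (𝓝 (Y ω x)) := by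
    filter_upwards [hfin] with ω hω
    have hex := exists_continuousMap_of_incrementSum hω
    simp only [Y, dif_pos hex]
    exact hex.choose_spec x
  have hL2 : Tendsto (fun m ↦ eLpNorm (X (gridPoint m (gridFloor m x)) - X x) 2 μ) atTop (𝓝 0) := by
    have he (u : E d) : eLpNorm (X u - X x) 2 μ
        = (ENNReal.ofReal (K u u + K x x - 2 * K u x) * stdMoment 2) ^ (1 / 2 : ℝ) := by
      have h1 := h.lintegral_enorm_sub_pow 1 u x
      rw [pow_one, mul_one] at h1
      rw [eLpNorm_eq_lintegral_rpow_enorm_toReal two_ne_zero ENNReal.ofNat_ne_top, ← h1]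
      simp
    simp only [he]
    have h0 : Tendsto (fun m ↦ ENNReal.ofReal (K (gridPoint m (gridFloor m x))
        (gridPoint m (gridFloor m x)) + K x x - 2 * K (gridPoint m (gridFloor m x)) x)) atTop
        (𝓝 0) := by
      have h1 : Tendsto (fun m ↦ ENNReal.ofReal (L * ‖gridPoint m (gridFloor m x) - x‖)) atTop
          (𝓝 0) := by
        have := (tendsto_iff_norm_sub_tendsto_zero.1 (tendsto_gridPoint_floor x)).const_mul L
        rw [mul_zero] at this
        simpa using ENNReal.tendsto_ofReal this
      exact tendsto_of_tendsto_of_tendsto_of_le_of_le tendsto_const_nhds h1 (fun _ ↦ zero_le)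
        fun m ↦ ENNReal.ofReal_le_ofReal (hK _ _)
    have h2 := (ENNReal.Tendsto.mul_const h0 (.inr (stdMoment_lt_top 2).ne)).ennrpow_const (1 / 2)
    simpa using h2
  -- The values at the grid points tend almost surely to the value of Y at x and in mean square to X
  -- x; limits in measure are almost surely unique.
  have h1 := tendstoInMeasure_of_tendsto_ae (fun m ↦ (hX _).aestronglyMeasurable) hY
  have h2 := tendstoInMeasure_of_tendsto_eLpNorm two_ne_zero
    (fun m ↦ (hX _).aestronglyMeasurable) (hX x).aestronglyMeasurable hL2
  exact tendstoInMeasure_ae_unique h1 h2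

/-- A characteristic function involves finitely many points, at all of which Y and X agree almost
surely. -/
lemma IsContinuousVersion.law (h : IsCentredGaussianField X μ K) {Y : Ω → C(E d, ℝ)}
    (hY : IsContinuousVersion X Y μ) :
    AEMeasurable Y μ ∧
      IsCentredGaussianField (fun (x : E d) (f : C(E d, ℝ)) ↦ f x) (μ.map Y) K := by
  have := h.gaussian.isProbabilityMeasure
  have hm : AEMeasurable Y μ := aemeasurable_continuousMap fun x ↦
    (h.gaussian.aemeasurable x).congr ((hY x).mono fun _ ↦ Eq.symm)
  have := Measure.isProbabilityMeasure_map hm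
  refine ⟨hm, .of_integral_cexp (fun x ↦ (measurable_eval_const x).aemeasurable) h.symm
    h.quadForm_nonneg fun F a ↦ ?_⟩
  have hlin : AEMeasurable (linComb (fun (x : E d) (f : C(E d, ℝ)) ↦ f x) F a) (μ.map Y) :=
    aemeasurable_linComb (fun x ↦ (measurable_eval_const x).aemeasurable) F a
  rw [← h.integral_cexp, integral_map hm (by fun_prop)]
  refine integral_congr_ae ?_
  have hall : ∀ᵐ ω ∂μ, ∀ x ∈ F, Y ω x = X x ω :=
    (ae_ball_iff F.countable_toSet).2 fun x _ ↦ hY x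
  filter_upwards [hall] with ω hω
  have : linComb (fun (x : E d) (f : C(E d, ℝ)) ↦ f x) F a (Y ω) = linComb X F a ω :=
    Finset.sum_congr rfl fun x hx ↦ congrArg (a x * ·) (hω x hx)
  rw [this]

/-- Continuous versions of centred Gaussian fields with uniformly bounded mean square increments
are uniformly tight. -/
theorem exists_compact_of_increments (d : ℕ) (hL : 0 ≤ L) (V : ℝ) {ε : ℝ≥0∞} (hε : 0 < ε) :
    ∃ A : Set C(E d, ℝ), IsCompact A ∧ ∀ {Ω : Type*} [MeasurableSpace Ω] {μ : Measure Ω}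
      {X : E d → Ω → ℝ} {K : E d → E d → ℝ}, IsCentredGaussianField X μ K →
      (∀ x y, K x x + K y y - 2 * K x y ≤ L * ‖x - y‖) → K 0 0 ≤ V →
      ∀ {Y : Ω → C(E d, ℝ)}, IsContinuousVersion X Y μ → μ.map Y Aᶜ ≤ ε := by
  obtain ⟨η, hη, hηε⟩ := ENNReal.lt_iff_exists_nnreal_btwn.1 hε
  have hη' : (0 : ℝ) < η := by exact_mod_cast hη
  choose C hC using fun N ↦ exists_lintegral_incrementSum_le d N hL
  obtain ⟨ε', hε', hsum⟩ := ENNReal.exists_pos_sum_of_countable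
    (ENNReal.coe_ne_zero.2 (half_pos (ENNReal.coe_pos.1 hη)).ne') ℕ
  -- By Markov's inequality the increment sum of the N-th box reaches R N with probability at most
  -- ε' N, and these add up to less than η/2. The 1 added to C N keeps R N positive.
  set R : ℕ → ℝ≥0 := fun N ↦ (C N + 1) / ε' N with hR
  -- The other η/2 goes to the value at the origin, by Chebyshev's inequality.
  set R₀ : ℝ := √((|V| + 1) / (η / 2)) with hR₀
  have hR₀pos : 0 < R₀ := Real.sqrt_pos.2 (by positivity)
  refine ⟨{f | HasModulus R₀ (fun N ↦ chainModulus (R N)) f},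
    isCompact_setOf_hasModulus fun N ↦ tendsto_chainModulus _, ?_⟩
  intro Ω _ μ X K h hK hV Y hY
  obtain ⟨hYm, -⟩ := hY.law h
  have hclosed : IsClosed {f : C(E d, ℝ) | HasModulus R₀ (fun N ↦ chainModulus (R N)) f} :=
    (isCompact_setOf_hasModulus fun N ↦ tendsto_chainModulus _).isClosed
  rw [Measure.map_apply_of_aemeasurable hYm hclosed.measurableSet.compl]
  -- Countably many almost sure equalities suffice: the increment sums see grid points only, and
  -- continuity of Y extends the modulus to all points.
  have hgrid : ∀ᵐ ω ∂μ, Y ω 0 = X 0 ω ∧ ∀ m k, Y ω (gridPoint m k) = X (gridPoint m k) ω :=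
    (hY 0).and (ae_all_iff.2 fun m ↦ ae_all_iff.2 fun k ↦ hY _)
  have hsub : Y ⁻¹' {f | HasModulus R₀ (fun N ↦ chainModulus (R N)) f}ᶜ ≤ᵐ[μ]
      ({ω | R₀ < |X 0 ω|} ∪ ⋃ N, {ω | (R N : ℝ≥0∞) ≤ incrementSum d N (X · ω)} : Set Ω) := by
    filter_upwards [hgrid] with ω hω hmem
    by_contra hcon
    replace hcon : ω ∉ ({ω | R₀ < |X 0 ω|} ∪
      ⋃ N, {ω | (R N : ℝ≥0∞) ≤ incrementSum d N (X · ω)} : Set Ω) := hcon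
    simp only [Set.mem_union, Set.mem_ofPred_eq, Set.mem_iUnion, not_or, not_lt, not_exists,
      not_le] at hcon
    refine hmem ⟨by rw [hω.1]; exact hcon.1, fun N m x hx y hy hxy ↦ ?_⟩
    have hinc : incrementSum d N (Y ω) ≤ ENNReal.ofReal (R N) := by
      rw [ENNReal.ofReal_coe_nnreal]
      refine le_trans (le_of_eq ?_) (hcon.2 N).le
      simp only [incrementSum, hω.2]
    have hmod := gridModulus_of_incrementSum_le (R N).coe_nonneg hinc
    exact hmod.abs_limit_sub_le (summable_chain _) hx hy hxy
      (((Y ω).continuous.tendsto x).comp (tendsto_gridPoint_floor x))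
      (((Y ω).continuous.tendsto y).comp (tendsto_gridPoint_floor y))
  have h0 : μ {ω | R₀ < |X 0 ω|} ≤ ((η / 2 : ℝ≥0) : ℝ≥0∞) := by
    refine (h.measure_abs_gt_le 0 hR₀pos).trans ?_
    rw [← ENNReal.ofReal_coe_nnreal]
    refine ENNReal.ofReal_le_ofReal ?_
    rw [hR₀, Real.sq_sqrt (by positivity), div_div_eq_mul_div, div_le_iff₀ (by positivity)]
    push_cast
    rw [mul_comm (η / 2 : ℝ)]
    gcongr
    linarith [le_abs_self V]
  have hN (N : ℕ) : μ {ω | (R N : ℝ≥0∞) ≤ incrementSum d N (X · ω)} ≤ ε' N := by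
    have hpos : 0 < R N := div_pos (by positivity) (hε' N)
    have h1 : (R N : ℝ≥0∞) * μ {ω | (R N : ℝ≥0∞) ≤ incrementSum d N (X · ω)} ≤ C N := by
      refine (mul_meas_ge_le_lintegral₀ ?_ _).trans (hC N h hK)
      unfold incrementSum
      refine AEMeasurable.tsum fun m ↦ Finset.aemeasurable_fun_sum _ fun k _ ↦
        Finset.aemeasurable_fun_sum _ fun e _ ↦ ?_
      have := h.gaussian.aemeasurable (gridPoint m (k + e))
      have := h.gaussian.aemeasurable (gridPoint m k)
      fun_prop
    have h2 : (C N : ℝ≥0∞) ≤ (R N : ℝ≥0∞) * ε' N := by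
      rw [← ENNReal.coe_mul, hR, div_mul_cancel₀ _ (hε' N).ne']
      exact_mod_cast le_self_add
    exact (ENNReal.mul_le_mul_iff_right (by exact_mod_cast hpos.ne') (by simp)).1 (h1.trans h2)
  calc _ ≤ _ := measure_mono_ae hsub
    _ ≤ _ := measure_union_le _ _
    _ ≤ ((η / 2 : ℝ≥0) : ℝ≥0∞) + ((η / 2 : ℝ≥0) : ℝ≥0∞) := by
      refine add_le_add h0 ((measure_iUnion_le _).trans ?_)
      exact (ENNReal.tsum_le_tsum hN).trans hsum.le
    _ = η := by rw [← ENNReal.coe_add, add_halves]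
    _ ≤ ε := hηε.le

end Versions

/-! ### Weak convergence from tightness and convergence of covariances. -/

section Convergence

variable {d : ℕ}

/-- The bounded continuous function `f ↦ exp (i ∑ a_s f(s))` on `C(ℝ^d)`. -/
noncomputable def cexpEval (F : Finset (E d)) (a : E d → ℝ) :
    BoundedContinuousFunction C(E d, ℝ) ℂ :=
  BoundedContinuousFunction.ofNormedAddCommGroup
    (fun f ↦ Complex.exp (linComb (fun (x : E d) (f : C(E d, ℝ)) ↦ f x) F a f * Complex.I))
    (by unfold linComb; fun_prop) 1 fun f ↦ (Complex.norm_exp_ofReal_mul_I _).le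

/-- Weak convergence of centred Gaussian fields on `ℝ^d` from pointwise convergence of their
covariances and a uniform bound for their mean square increments. -/
theorem convergesWeaklyToGaussian_of_increments {Ω : ℕ → Type*} [∀ n, MeasurableSpace (Ω n)]
    {X : ∀ n, E d → Ω n → ℝ} {μ : ∀ n, Measure (Ω n)} [∀ n, IsProbabilityMeasure (μ n)]
    {Kn : ℕ → E d → E d → ℝ} {K : E d → E d → ℝ} {L : ℝ} (hL : 0 ≤ L)
    (hX : ∀ n, IsCentredGaussianField (X n) (μ n) (Kn n))
    (hinc : ∀ n x y, Kn n x x + Kn n y y - 2 * Kn n x y ≤ L * ‖x - y‖)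
    (hK : ∀ x y, Tendsto (fun n ↦ Kn n x y) atTop (𝓝 (K x y))) :
    ConvergesWeaklyToGaussian X μ K := by
  have hver n := (hX n).exists_continuousVersion hL (hinc n)
  refine ⟨hver, ?_⟩
  choose Y₀ hY₀ using hver
  let P (n : ℕ) : ProbabilityMeasure C(E d, ℝ) :=
    ⟨(μ n).map (Y₀ n), Measure.isProbabilityMeasure_map ((hY₀ n).law (hX n)).1⟩
  have hP n : IsCentredGaussianField (fun (x : E d) (f : C(E d, ℝ)) ↦ f x)
    (P n : Measure C(E d, ℝ)) (Kn n) := ((hY₀ n).law (hX n)).2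
  obtain ⟨V, hV⟩ := (hK 0 0).bddAbove_range
  have htight : IsTightMeasureSet {((ν : ProbabilityMeasure C(E d, ℝ)) : Measure C(E d, ℝ)) |
      ν ∈ Set.range P} := by
    rw [isTightMeasureSet_iff_exists_isCompact_measure_compl_le]
    intro ε hε
    obtain ⟨A, hA, hA'⟩ := exists_compact_of_increments d hL V hε
    refine ⟨A, hA, ?_⟩
    rintro _ ⟨_, ⟨n, rfl⟩, rfl⟩
    exact hA' (hX n) (hinc n) (hV ⟨n, rfl⟩) (hY₀ n)
  have hcomp := isCompact_closure_of_isTightMeasureSet htight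
  have hmem : ∀ᶠ n in atTop, P n ∈ closure (Set.range P) :=
    .of_forall fun n ↦ subset_closure ⟨n, rfl⟩
  -- Along an ultrafilter realising the cluster point the laws converge, and testing against
  -- `cexpEval F a` gives the limiting characteristic functions.
  have hclus (ν : ProbabilityMeasure C(E d, ℝ)) (hν : MapClusterPt ν atTop P) :
      IsCentredGaussianField (fun (x : E d) (f : C(E d, ℝ)) ↦ f x)
        (ν : Measure C(E d, ℝ)) K := by
    obtain ⟨U, hU, hUν⟩ := mapClusterPt_iff_ultrafilter.1 hν
    refine .of_tendsto (l := (U : Filter ℕ)) hP (fun x y ↦ (hK x y).mono_left hU)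
      (fun x ↦ (measurable_eval_const x).aemeasurable) fun F a ↦ ?_
    exact (ProbabilityMeasure.tendsto_iff_forall_integral_rclike_tendsto ℂ).1 hUν (cexpEval F a)
  obtain ⟨P', -, hP'⟩ := hcomp.exists_mapClusterPt_of_frequently hmem.frequently
  have hG := hclus P' hP'
  have huniq (Q : ProbabilityMeasure C(E d, ℝ))
      (hQ : IsCentredGaussianField (fun (x : E d) (f : C(E d, ℝ)) ↦ f x)
        (Q : Measure C(E d, ℝ)) K) : Q = P' :=
    Subtype.ext (have := P'.2; have := Q.2; hQ.law_unique hG)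
  -- A sequence in a compact set with only one cluster point converges to it.
  have hlim : Tendsto P atTop (𝓝 P') :=
    hcomp.tendsto_nhds_of_unique_mapClusterPt hmem fun ν _ hν ↦ huniq ν (hclus ν hν)
  refine ⟨P', hG, huniq, fun Y hY ↦ ⟨fun n ↦ ((hY n).law (hX n)).1, ?_⟩⟩
  refine hlim.congr fun n ↦ Subtype.ext ?_
  have := Measure.isProbabilityMeasure_map ((hY n).law (hX n)).1
  exact (hP n).law_unique ((hY n).law (hX n)).2

end Convergence
end GaussField

namespace GaussField

/-! ### From decay of the spectral density to bounds on increments. -/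

section Spectral

variable {d : ℕ}

lemma norm_fourierKernel_mul (x ξ : E d) (s : ℝ) :
    ‖Complex.exp (-(Complex.I * ((inner ℝ x ξ : ℝ) : ℂ))) * (s : ℂ)‖ = |s| := by
  rw [norm_mul, Complex.norm_real, Real.norm_eq_abs, Complex.norm_exp]
  simp

lemma integrable_fourierKernel_mul {S : E d → ℝ} (hS : Integrable S) (x : E d) :
    Integrable fun ξ : E d ↦ Complex.exp (-(Complex.I * ((inner ℝ x ξ : ℝ) : ℂ))) * (S ξ : ℂ) := by
  refine hS.norm.mono' ?_ (.of_forall fun ξ ↦ (norm_fourierKernel_mul x ξ (S ξ)).le)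
  refine AEStronglyMeasurable.mul ?_ (Complex.continuous_ofReal.comp_aestronglyMeasurable hS.1)
  exact Continuous.aestronglyMeasurable (by fun_prop)

lemma re_invFourier {S : E d → ℝ} (hS : Integrable S) (x : E d) :
    (invFourier S x).re = ((2 * Real.pi) ^ d)⁻¹ * ∫ ξ : E d, Real.cos (inner ℝ x ξ) * S ξ := by
  have h1 : (((2 * Real.pi : ℝ) ^ d : ℂ))⁻¹ = (((2 * Real.pi) ^ d)⁻¹ : ℝ) := by push_cast; rfl
  rw [invFourier, h1, Complex.re_ofReal_mul]
  congr 1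
  have h2 := integral_re (𝕜 := ℂ) (integrable_fourierKernel_mul hS x)
  simp only [RCLike.re_eq_complex_re] at h2
  rw [← h2]
  congr 1
  ext ξ
  rw [Complex.re_mul_ofReal, show -(Complex.I * ((inner ℝ x ξ : ℝ) : ℂ))
    = ((-(inner ℝ x ξ) : ℝ) : ℂ) * Complex.I by push_cast; ring, Complex.exp_ofReal_mul_I_re,
    Real.cos_neg]

/-- Unlike the quadratic bound, this linear one costs only a single power of |ξ| under the spectral
integral. -/
lemma one_sub_cos_le_abs (t : ℝ) : 1 - Real.cos t ≤ |t| := by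
  rcases le_total |t| 2 with h | h
  · have := Real.one_sub_sq_div_two_le_cos (x := t)
    rw [← sq_abs] at this
    nlinarith [abs_nonneg t]
  · linarith [Real.neg_one_le_cos t]

lemma integrable_decay {r : ℝ} (hr : (d : ℝ) < r) :
    Integrable fun ξ : E d ↦ (1 + ‖ξ‖) ^ (-r) :=
  integrable_one_add_norm (by simpa using hr)

lemma integrable_of_decay {S : E d → ℝ} {c r : ℝ} (hr : (d : ℝ) < r)
    (hm : AEStronglyMeasurable S volume) (hS : ∀ᵐ ξ : E d, |S ξ| ≤ c * (1 + ‖ξ‖) ^ (-r)) :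
    Integrable S :=
  ((integrable_decay hr).const_mul c).mono' hm hS

/-- The mean square increments of a stationary field with rapidly decaying spectral density. -/
lemma invFourier_zero_sub_le {S : E d → ℝ} {c r : ℝ} (hr : (d : ℝ) + 1 < r)
    (hm : AEStronglyMeasurable S volume) (hS : ∀ᵐ ξ : E d, |S ξ| ≤ c * (1 + ‖ξ‖) ^ (-r)) (x : E d) :
    (invFourier S 0).re - (invFourier S x).re
      ≤ ((2 * Real.pi) ^ d)⁻¹ * (c * ∫ ξ : E d, (1 + ‖ξ‖) ^ (-(r - 1))) * ‖x‖ := by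
  have hi := integrable_of_decay (by linarith) hm hS
  have hcos (y : E d) : Integrable fun ξ : E d ↦ Real.cos (inner ℝ y ξ) * S ξ :=
    hi.bdd_mul (c := 1) (Continuous.aestronglyMeasurable (by fun_prop))
      (.of_forall fun ξ ↦ Real.abs_cos_le_one _)
  rw [re_invFourier hi, re_invFourier hi, ← mul_sub, ← integral_sub (hcos 0) (hcos x), mul_assoc]
  refine mul_le_mul_of_nonneg_left ?_ (by positivity)
  rw [← integral_const_mul, ← integral_mul_const]
  refine integral_mono_ae ((hcos 0).sub (hcos x))
    (((integrable_decay (by linarith)).const_mul c).mul_const _) ?_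
  filter_upwards [hS] with ξ hξ
  have h1 : Real.cos (inner ℝ (0 : E d) ξ) * S ξ - Real.cos (inner ℝ x ξ) * S ξ
      = (1 - Real.cos (inner ℝ x ξ)) * S ξ := by
    rw [inner_zero_left, Real.cos_zero]; ring
  have h2 : 1 - Real.cos (inner ℝ x ξ) ≤ ‖x‖ * ‖ξ‖ :=
    (one_sub_cos_le_abs _).trans (abs_real_inner_le_norm x ξ)
  have h3 : 0 ≤ 1 - Real.cos (inner ℝ x ξ) := by linarith [Real.cos_le_one (inner ℝ x ξ)]
  have h0 : (0 : ℝ) < 1 + ‖ξ‖ := by positivity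
  simp only [h1]
  calc (1 - Real.cos (inner ℝ x ξ)) * S ξ ≤ (1 - Real.cos (inner ℝ x ξ)) * |S ξ| :=
        mul_le_mul_of_nonneg_left (le_abs_self _) h3
    _ ≤ (‖x‖ * ‖ξ‖) * (c * (1 + ‖ξ‖) ^ (-r)) :=
        mul_le_mul h2 hξ (abs_nonneg _) (by positivity)
    _ ≤ (‖x‖ * (1 + ‖ξ‖)) * (c * (1 + ‖ξ‖) ^ (-r)) := by
        have := (abs_nonneg _).trans hξ
        gcongr
        linarith
    _ = _ := by
        rw [show -(r - 1) = 1 + -r by ring, Real.rpow_add h0, Real.rpow_one]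
        ring

/-- Weak convergence of stationary Gaussian fields whose spectral densities decay uniformly. -/
theorem convergesWeaklyToGaussian_of_decay {Ω : ℕ → Type*} [∀ n, MeasurableSpace (Ω n)]
    {X : ∀ n, E d → Ω n → ℝ} {μ : ∀ n, Measure (Ω n)} [∀ n, IsProbabilityMeasure (μ n)]
    {S : ℕ → E d → ℝ} {K : E d → E d → ℝ} {c r : ℝ} (hr : (d : ℝ) + 1 < r)
    (hm : ∀ n, AEStronglyMeasurable (S n) volume)
    (hS : ∀ n, ∀ᵐ ξ : E d, |S n ξ| ≤ c * (1 + ‖ξ‖) ^ (-r))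
    (hX : ∀ n, IsCentredGaussianField (X n) (μ n) fun x y ↦ (invFourier (S n) (x - y)).re)
    (hK : ∀ x y, Tendsto (fun n ↦ (invFourier (S n) (x - y)).re) atTop (𝓝 (K x y))) :
    ConvergesWeaklyToGaussian X μ K := by
  have hc : 0 ≤ c := by
    obtain ⟨ξ, hξ⟩ := (hS 0).exists
    have h0 : 0 < (1 + ‖ξ‖) ^ (-r) := Real.rpow_pos_of_pos (by positivity) _
    by_contra! hc
    linarith [abs_nonneg (S 0 ξ), mul_neg_of_neg_of_pos hc h0]
  have hI : 0 ≤ ∫ ξ : E d, (1 + ‖ξ‖) ^ (-(r - 1)) := integral_nonneg fun ξ ↦ by positivity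
  refine convergesWeaklyToGaussian_of_increments
    (L := 2 * (((2 * Real.pi) ^ d)⁻¹ * (c * ∫ ξ : E d, (1 + ‖ξ‖) ^ (-(r - 1)))))
    (by positivity) hX (fun n x y ↦ ?_) hK
  have := invFourier_zero_sub_le hr (hm n) (hS n) (x - y)
  rw [sub_self, sub_self]
  linarith

lemma tendsto_invFourier {S : ℕ → E d → ℝ} {S' : E d → ℝ} {c r : ℝ} (hr : (d : ℝ) < r)
    (hm : ∀ n, AEStronglyMeasurable (S n) volume)
    (hS : ∀ n, ∀ᵐ ξ : E d, |S n ξ| ≤ c * (1 + ‖ξ‖) ^ (-r))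
    (hlim : ∀ᵐ ξ : E d, Tendsto (fun n ↦ S n ξ) atTop (𝓝 (S' ξ))) (x : E d) :
    Tendsto (fun n ↦ invFourier (S n) x) atTop (𝓝 (invFourier S' x)) := by
  refine Tendsto.const_mul _ (tendsto_integral_of_dominated_convergence _
    (fun n ↦ (integrable_fourierKernel_mul (integrable_of_decay hr (hm n) (hS n)) x).1)
    ((integrable_decay hr).const_mul c) (fun n ↦ ?_) ?_)
  · filter_upwards [hS n] with ξ hξ
    rwa [norm_fourierKernel_mul]
  · filter_upwards [hlim] with ξ hξ
    exact ((Complex.continuous_ofReal.tendsto _).comp hξ).const_mul _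

/-- Weak convergence of stationary Gaussian fields from almost everywhere convergence of their
spectral densities. -/
theorem convergesWeaklyToGaussian_of_tendsto_density {Ω : ℕ → Type*}
    [∀ n, MeasurableSpace (Ω n)]
    {X : ∀ n, E d → Ω n → ℝ} {μ : ∀ n, Measure (Ω n)} [∀ n, IsProbabilityMeasure (μ n)]
    {S : ℕ → E d → ℝ} {S' : E d → ℝ} {c r : ℝ} (hr : (d : ℝ) + 1 < r)
    (hm : ∀ n, AEStronglyMeasurable (S n) volume)
    (hS : ∀ n, ∀ᵐ ξ : E d, |S n ξ| ≤ c * (1 + ‖ξ‖) ^ (-r))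
    (hlim : ∀ᵐ ξ : E d, Tendsto (fun n ↦ S n ξ) atTop (𝓝 (S' ξ)))
    (hX : ∀ n, IsCentredGaussianField (X n) (μ n) fun x y ↦ (invFourier (S n) (x - y)).re) :
    ConvergesWeaklyToGaussian X μ fun x y ↦ (invFourier S' (x - y)).re :=
  convergesWeaklyToGaussian_of_decay hr hm hS hX fun x y ↦
    (Complex.continuous_re.tendsto _).comp
      (tendsto_invFourier (by linarith) hm hS hlim (x - y))

/-- The two forms of decay are compared through 1 + t ≤ 2 max(1, t). -/
lemma div_one_add_rpow_le {c s t : ℝ} (hc : 0 ≤ c) (hs : 0 ≤ s) (ht : 0 ≤ t) :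
    c / (1 + t ^ s) ≤ c * 2 ^ s * (1 + t) ^ (-s) := by
  have h1 : (1 + t) ^ s ≤ 2 ^ s * (1 + t ^ s) := by
    have ht' : 0 ≤ t ^ s := Real.rpow_nonneg ht s
    have h2 : (0 : ℝ) < 2 ^ s := by positivity
    rcases le_total t 1 with h | h
    · calc (1 + t) ^ s ≤ 2 ^ s := Real.rpow_le_rpow (by linarith) (by linarith) hs
        _ ≤ _ := by nlinarith
    · calc (1 + t) ^ s ≤ (2 * t) ^ s := Real.rpow_le_rpow (by linarith) (by linarith) hs
        _ = 2 ^ s * t ^ s := Real.mul_rpow zero_le_two ht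
        _ ≤ _ := by nlinarith
  have h3 : 0 < (1 + t) ^ s := by positivity
  rw [Real.rpow_neg (by linarith), div_le_iff₀ (by positivity), mul_assoc, mul_assoc]
  refine le_mul_of_one_le_right hc ?_
  rw [mul_left_comm, ← div_eq_inv_mul, one_le_div h3]
  exact h1

theorem convergesWeaklyToGaussian_of_spectralDensity {Ω : ℕ → Type*}
    [∀ n, MeasurableSpace (Ω n)] (μ : ∀ n, Measure (Ω n)) [∀ n, IsProbabilityMeasure (μ n)]
    (X : ∀ n, E d → Ω n → ℝ) (Cn S : ℕ → E d → ℝ) (C : E d → E d → ℝ) {c s : ℝ}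
    (hc : 0 < c) (hs : ((d : ℝ) + 1) / 2 < s)
    (hX : ∀ n, IsCentredGaussianField (X n) (μ n) (fun x y ↦ Cn n (x - y)))
    (hspec : ∀ n, HasSpectralDensity (Cn n) (S n))
    (hS : ∀ n, ∀ᵐ ξ : E d, |S n ξ| ≤ c / (1 + ‖ξ‖ ^ (2 * s)))
    (hC : ∀ x y, Tendsto (fun n ↦ Cn n (x - y)) atTop (𝓝 (C x y))) :
    ConvergesWeaklyToGaussian X μ C := by
  have hCn n x : Cn n x = (invFourier (S n) x).re := by
    rw [← (hspec n).2 x, Complex.ofReal_re]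
  have hs' : 0 ≤ 2 * s := by linarith [(Nat.cast_nonneg d : (0 : ℝ) ≤ d)]
  simp only [hCn] at hX hC
  refine convergesWeaklyToGaussian_of_decay (r := 2 * s) (c := c * 2 ^ (2 * s)) (by linarith) (fun n ↦ (hspec n).1.1)
    (fun n ↦ ?_) hX hC
  filter_upwards [hS n] with ξ hξ
  exact hξ.trans (div_one_add_rpow_le hc.le hs' (norm_nonneg _))

end Spectral
end GaussField

namespace GaussField

/-! ### Lower bounds for the truncated binomial series. -/

section Taylor

lemma taylorCoeff_zero (α : ℝ) : taylorCoeff α 0 = 1 := by simp [taylorCoeff]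

lemma taylorCoeff_succ (α : ℝ) (k : ℕ) :
    taylorCoeff α (k + 1) = taylorCoeff α k * (α - k) / (k + 1) := by
  have : (k.factorial : ℝ) ≠ 0 := by positivity
  rw [taylorCoeff, taylorCoeff, Finset.prod_range_succ, Nat.factorial_succ]
  push_cast
  field_simp

/-- By this identity the derivative of a Taylor polynomial for α is α times the one of lower order
for α - 1. -/
lemma succ_mul_taylorCoeff (α : ℝ) (k : ℕ) :
    (k + 1) * taylorCoeff α (k + 1) = α * taylorCoeff (α - 1) k := by
  have : (k.factorial : ℝ) ≠ 0 := by positivity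
  rw [taylorCoeff, taylorCoeff, Finset.prod_range_succ', Nat.factorial_succ]
  push_cast
  have h : ∏ i ∈ Finset.range k, (α - (i + 1)) = ∏ i ∈ Finset.range k, (α - 1 - i) :=
    Finset.prod_congr rfl fun i _ ↦ by ring
  rw [h]
  field_simp
  ring

/-- The Taylor polynomial of `(1 + x)^α`. -/
noncomputable def binomPoly (α : ℝ) (K : ℕ) (x : ℝ) : ℝ :=
  ∑ k ∈ Finset.range (K + 1), taylorCoeff α k * x ^ k

lemma binomPoly_succ (α : ℝ) (K : ℕ) (x : ℝ) :
    binomPoly α (K + 1) x = binomPoly α K x + taylorCoeff α (K + 1) * x ^ (K + 1) :=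
  Finset.sum_range_succ _ _

lemma taylorPoly_eq (α : ℝ) {κ : ℝ} (hκ : 0 < κ) (K : ℕ) (t : ℝ) :
    taylorPoly α κ K t = κ ^ (2 * α) * binomPoly α K (t / κ ^ 2) := by
  rw [taylorPoly, binomPoly, Finset.mul_sum]
  refine Finset.sum_congr rfl fun k _ ↦ ?_
  have : κ ^ (2 * (α - k)) = κ ^ (2 * α) / (κ ^ 2) ^ k := by
    rw [mul_sub, Real.rpow_sub hκ, ← pow_mul, ← Real.rpow_natCast κ (2 * k)]
    push_cast
    rfl
  rw [this, div_pow]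
  ring

lemma hasDerivAt_binomPoly (α : ℝ) (K : ℕ) (x : ℝ) :
    HasDerivAt (binomPoly α (K + 1)) (α * binomPoly (α - 1) K x) x := by
  have h : HasDerivAt (binomPoly α (K + 1))
      (∑ k ∈ Finset.range (K + 2), taylorCoeff α k * (k * x ^ (k - 1))) x := by
    unfold binomPoly
    exact HasDerivAt.fun_sum fun k _ ↦ (hasDerivAt_pow k x).const_mul _
  convert h using 1
  rw [Finset.sum_range_succ', binomPoly, Finset.mul_sum]
  simp only [Nat.cast_zero, zero_mul, mul_zero, add_zero, Nat.add_sub_cancel]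
  refine Finset.sum_congr rfl fun k _ ↦ ?_
  have := succ_mul_taylorCoeff α k
  push_cast
  linear_combination -(x ^ k) * this

/-- The sign of the Taylor remainder of `(1 + x)^α` is that of the first omitted term. -/
lemma taylorCoeff_mul_remainder_nonpos (α : ℝ) (K : ℕ) {x : ℝ} (hx : 0 ≤ x) :
    taylorCoeff α (K + 1) * (binomPoly α K x - (1 + x) ^ α) ≤ 0 := by
  induction K generalizing α x with
  | zero =>
    have h1 : taylorCoeff α (0 + 1) = α := by simp [taylorCoeff]
    have h2 : binomPoly α 0 x = 1 := by simp [binomPoly, taylorCoeff]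
    rw [h1, h2]
    rcases le_total 0 α with h | h
    · have := Real.one_le_rpow (by linarith : (1 : ℝ) ≤ 1 + x) h
      nlinarith
    · have := Real.rpow_le_one_of_one_le_of_nonpos (by linarith : (1 : ℝ) ≤ 1 + x) h
      nlinarith
  | succ K ih =>
    -- Differentiating the remainder lowers the order by one and replaces α by α - 1. The
    -- coefficient identity produces the factor α²/(K+2) ≥ 0, so by the induction hypothesis G is
    -- nonincreasing, and G 0 = 0.
    set G : ℝ → ℝ := fun x ↦ taylorCoeff α (K + 1 + 1) * (binomPoly α (K + 1) x - (1 + x) ^ α)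
    have hder (y : ℝ) (hy : 0 ≤ y) : HasDerivAt G (taylorCoeff α (K + 1 + 1) *
        (α * binomPoly (α - 1) K y - α * (1 + y) ^ (α - 1))) y := by
      have h1 : HasDerivAt (fun y : ℝ ↦ (1 + y) ^ α) (α * (1 + y) ^ (α - 1)) y := by
        have := ((hasDerivAt_id y).const_add 1).rpow_const (p := α) (.inl (by simp; linarith))
        simpa using this
      exact ((hasDerivAt_binomPoly α K y).sub h1).const_mul _
    have hanti : AntitoneOn G (Set.Ici 0) := by
      refine antitoneOn_of_deriv_nonpos (convex_Ici 0)
        (fun y hy ↦ (hder y hy).continuousAt.continuousWithinAt) ?_ ?_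
      · intro y hy
        rw [interior_Ici] at hy
        exact (hder y hy.le).differentiableAt.differentiableWithinAt
      · intro y hy
        rw [interior_Ici] at hy
        rw [(hder y hy.le).deriv]
        have h1 := succ_mul_taylorCoeff α (K + 1)
        have h2 := ih (α - 1) hy.le
        have h3 : taylorCoeff α (K + 1 + 1)
            = α / ((K + 1 : ℕ) + 1) * taylorCoeff (α - 1) (K + 1) := by
          field_simp
          linarith
        have h4 : taylorCoeff α (K + 1 + 1) *
            (α * binomPoly (α - 1) K y - α * (1 + y) ^ (α - 1)) = α ^ 2 / ((K + 1 : ℕ) + 1) *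
            (taylorCoeff (α - 1) (K + 1) * (binomPoly (α - 1) K y - (1 + y) ^ (α - 1))) := by
          rw [h3]; ring
        rw [h4]
        exact mul_nonpos_of_nonneg_of_nonpos (by positivity) h2
    have h0 : G 0 = 0 := by
      simp only [G, binomPoly, Finset.sum_range_succ']
      simp [taylorCoeff_zero]
    have := hanti Set.self_mem_Ici hx hx
    rw [h0] at this
    exact this

variable {α : ℝ}

lemma taylorCoeff_pos (hα : 0 < α) (hn : ∀ m : ℕ, α ≠ m) {k : ℕ} (hk : k ≤ ⌊α⌋₊ + 1) :
    0 < taylorCoeff α k := by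
  refine div_pos (Finset.prod_pos fun i hi ↦ ?_) (by positivity)
  have h1 : i ≤ ⌊α⌋₊ := by have := Finset.mem_range.1 hi; omega
  have h2 : (i : ℝ) ≤ α := (Nat.le_floor_iff hα.le).1 h1
  exact sub_pos.2 (h2.lt_of_ne (hn i).symm)

lemma lt_of_floor_lt {k : ℕ} (hk : ⌊α⌋₊ + 1 ≤ k) : α < k :=
  (Nat.lt_floor_add_one α).trans_le (by exact_mod_cast hk)

/-- The coefficient at ⌊α⌋ + 1 is positive, and from there on each new factor α - k is negative. -/
lemma neg_one_pow_mul_taylorCoeff_pos (hα : 0 < α) (hn : ∀ m : ℕ, α ≠ m) (j : ℕ) :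
    0 < (-1) ^ j * taylorCoeff α (⌊α⌋₊ + 1 + j) := by
  induction j with
  | zero => simpa using taylorCoeff_pos hα hn le_rfl
  | succ j ih =>
    rw [← add_assoc, taylorCoeff_succ, pow_succ]
    have h : α < ((⌊α⌋₊ + 1 + j : ℕ) : ℝ) := lt_of_floor_lt (by omega)
    have : (-1) ^ j * -1 * (taylorCoeff α (⌊α⌋₊ + 1 + j) * (α - (⌊α⌋₊ + 1 + j : ℕ))
        / ((⌊α⌋₊ + 1 + j : ℕ) + 1)) = ((-1) ^ j * taylorCoeff α (⌊α⌋₊ + 1 + j))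
        * (((⌊α⌋₊ + 1 + j : ℕ) - α) / ((⌊α⌋₊ + 1 + j : ℕ) + 1)) := by ring
    rw [this]
    exact mul_pos ih (div_pos (by linarith) (by positivity))

/-- The truncation orders `⌊α⌋ + 2J + 1`. -/
noncomputable def truncOrder (α : ℝ) (J : ℕ) : ℕ := ⌊α⌋₊ + 2 * J + 1

lemma taylorCoeff_truncOrder_pos (hα : 0 < α) (hn : ∀ m : ℕ, α ≠ m) (J : ℕ) :
    0 < taylorCoeff α (truncOrder α J) := by
  have := neg_one_pow_mul_taylorCoeff_pos hα hn (2 * J)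
  rwa [pow_mul, neg_one_sq, one_pow, one_mul, add_right_comm] at this

lemma taylorCoeff_truncOrder_succ_neg (hα : 0 < α) (hn : ∀ m : ℕ, α ≠ m) (J : ℕ) :
    taylorCoeff α (truncOrder α J + 1) < 0 := by
  have := neg_one_pow_mul_taylorCoeff_pos hα hn (2 * J + 1)
  rw [pow_succ, pow_mul, neg_one_sq, one_pow, one_mul, neg_one_mul, neg_pos, ← add_assoc,
    add_right_comm ⌊α⌋₊] at this
  exact this

/-- The parity of the order makes the first omitted coefficient negative, and this fixes the sign of
the remainder. -/
lemma le_binomPoly_truncOrder (hα : 0 < α) (hn : ∀ m : ℕ, α ≠ m) (J : ℕ) {x : ℝ} (hx : 0 ≤ x) :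
    (1 + x) ^ α ≤ binomPoly α (truncOrder α J) x := by
  have h1 := taylorCoeff_mul_remainder_nonpos α (truncOrder α J) hx
  have h2 := taylorCoeff_truncOrder_succ_neg hα hn J
  by_contra! h
  nlinarith

lemma one_le_binomPoly_truncOrder (hα : 0 < α) (hn : ∀ m : ℕ, α ≠ m) (J : ℕ) {x : ℝ}
    (hx : 0 ≤ x) : 1 ≤ binomPoly α (truncOrder α J) x :=
  (Real.one_le_rpow (by linarith) hα.le).trans (le_binomPoly_truncOrder hα hn J hx)

lemma truncOrder_gt (J : ℕ) : α < truncOrder α J :=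
  lt_of_floor_lt (by unfold truncOrder; omega)

lemma binomPoly_truncOrder_succ (J : ℕ) (x : ℝ) :
    binomPoly α (truncOrder α (J + 1)) x = binomPoly α (truncOrder α J) x
      + (taylorCoeff α (truncOrder α J + 1) * x ^ (truncOrder α J + 1)
      + taylorCoeff α (truncOrder α (J + 1)) * x ^ (truncOrder α (J + 1))) := by
  have : truncOrder α (J + 1) = truncOrder α J + 1 + 1 := by unfold truncOrder; ring
  rw [this, binomPoly_succ, binomPoly_succ]
  ring

/-- For k > α one has (k+1-α)(α+2) ≥ k+2, so a_(k+2) ≥ |a_(k+1)|/(α+2). Hence beyond x = α + 2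
raising J does not decrease the polynomial. -/
lemma le_two_terms (hα : 0 < α) (hn : ∀ m : ℕ, α ≠ m) (J : ℕ) {x : ℝ} (hx : 0 ≤ x) :
    taylorCoeff α (truncOrder α (J + 1)) * x ^ (truncOrder α J + 1) * (x - (α + 2))
      ≤ taylorCoeff α (truncOrder α J + 1) * x ^ (truncOrder α J + 1)
      + taylorCoeff α (truncOrder α (J + 1)) * x ^ (truncOrder α (J + 1)) := by
  have he : truncOrder α (J + 1) = truncOrder α J + 1 + 1 := by unfold truncOrder; ring
  have h1 := taylorCoeff_truncOrder_succ_neg hα hn J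
  have h2 := truncOrder_gt (α := α) J
  rw [he]
  rw [taylorCoeff_succ α (truncOrder α J + 1)]
  set a := taylorCoeff α (truncOrder α J + 1)
  set k : ℝ := (truncOrder α J : ℝ)
  have hx' : 0 ≤ x ^ (truncOrder α J + 1) := by positivity
  have h3 : 0 ≤ a * (α - (truncOrder α J + 1 : ℕ)) / ((truncOrder α J + 1 : ℕ) + 1) * (α + 2) + a := by
    have : a * (α - (truncOrder α J + 1 : ℕ)) / ((truncOrder α J + 1 : ℕ) + 1) * (α + 2) + a
        = (-a) * (((k + 1 - α) * (α + 2) - (k + 2)) / (k + 2)) := by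
      have hk : (0 : ℝ) < k + 2 := by positivity
      push_cast
      field_simp
      ring
    rw [this]
    refine mul_nonneg (by linarith) (div_nonneg ?_ (by positivity))
    nlinarith
  have h4 := mul_nonneg h3 hx'
  rw [pow_succ x (truncOrder α J + 1)]
  nlinarith

lemma binomPoly_truncOrder_mono (hα : 0 < α) (hn : ∀ m : ℕ, α ≠ m) {x : ℝ} (hx : α + 2 ≤ x) :
    Monotone fun J ↦ binomPoly α (truncOrder α J) x := by
  refine monotone_nat_of_le_succ fun J ↦ ?_
  have h1 := le_two_terms hα hn J (by linarith : 0 ≤ x)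
  have h2 : 0 ≤ taylorCoeff α (truncOrder α (J + 1)) * x ^ (truncOrder α J + 1) * (x - (α + 2)) :=
    mul_nonneg (mul_nonneg (taylorCoeff_truncOrder_pos hα hn _).le (pow_nonneg (by linarith) _))
      (by linarith)
  rw [binomPoly_truncOrder_succ]
  linarith

/-- A lower bound for the Taylor polynomials, uniform in the truncation order. -/
lemma exists_le_binomPoly (hα : 0 < α) (hn : ∀ m : ℕ, α ≠ m) :
    ∃ c > 0, ∀ J, 1 ≤ J → ∀ x, 0 ≤ x →
      c * (1 + x) ^ (⌊α⌋₊ + 3) ≤ binomPoly α (truncOrder α J) x := by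
  -- The order `truncOrder α 1` is ⌊α⌋ + 3. For x ≤ 2(α+2) the lower bound 1 suffices and fixes c₁.
  -- For larger x the two terms gained from J = 0 to J = 1 are at least (a/2)x^(⌊α⌋+3), monotonicity
  -- in J keeps this bound, and 1 + x ≤ 2x yields c₂.
  set a := taylorCoeff α (truncOrder α 1)
  have ha : 0 < a := taylorCoeff_truncOrder_pos hα hn 1
  set c₁ : ℝ := 1 / (1 + 2 * (α + 2)) ^ (⌊α⌋₊ + 3)
  set c₂ : ℝ := a / 2 * (1 / 2) ^ (⌊α⌋₊ + 3)
  have hc₁ : 0 < c₁ := by positivity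
  have hc₂ : 0 < c₂ := by positivity
  refine ⟨min c₁ c₂, lt_min hc₁ hc₂, fun J hJ x hx ↦ ?_⟩
  rcases le_total x (2 * (α + 2)) with h | h
  · calc min c₁ c₂ * (1 + x) ^ (⌊α⌋₊ + 3) ≤ c₁ * (1 + 2 * (α + 2)) ^ (⌊α⌋₊ + 3) := by
          gcongr
          exact min_le_left _ _
      _ = 1 := one_div_mul_cancel (by positivity)
      _ ≤ _ := one_le_binomPoly_truncOrder hα hn J hx
  · have h1 := le_two_terms hα hn 0 hx
    have h2 := binomPoly_truncOrder_succ (α := α) 0 x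
    have h3 := one_le_binomPoly_truncOrder hα hn 0 hx
    have h4 : binomPoly α (truncOrder α 1) x ≤ binomPoly α (truncOrder α J) x :=
      binomPoly_truncOrder_mono hα hn (by linarith) hJ
    have h5 : truncOrder α 0 + 1 + 1 = ⌊α⌋₊ + 3 := rfl
    have h6 : a / 2 * x ^ (⌊α⌋₊ + 3) ≤ a * x ^ (truncOrder α 0 + 1) * (x - (α + 2)) := by
      rw [← h5, pow_succ x (truncOrder α 0 + 1)]
      have : 0 ≤ a * x ^ (truncOrder α 0 + 1) := by positivity
      nlinarith
    calc min c₁ c₂ * (1 + x) ^ (⌊α⌋₊ + 3) ≤ c₂ * (2 * x) ^ (⌊α⌋₊ + 3) := by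
          gcongr
          · exact min_le_right _ _
          · linarith
      _ = a / 2 * x ^ (⌊α⌋₊ + 3) := by
          have : (1 / 2 : ℝ) ^ (⌊α⌋₊ + 3) * 2 ^ (⌊α⌋₊ + 3) = 1 := by
            rw [← mul_pow]; norm_num
          simp only [c₂]
          rw [mul_pow]
          linear_combination (a / 2 * x ^ (⌊α⌋₊ + 3)) * this
      _ ≤ binomPoly α (truncOrder α 1) x := by
          have h7 : binomPoly α (truncOrder α (0 + 1)) x = binomPoly α (truncOrder α 1) x := rfl
          have h8 : taylorCoeff α (truncOrder α (0 + 1)) = a := rfl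
          rw [h8] at h1 h2
          linarith
      _ ≤ _ := h4

lemma taylorPoly_pos (hα : 0 < α) (hn : ∀ m : ℕ, α ≠ m) {κ : ℝ} (hκ : 0 < κ) (J : ℕ) {t : ℝ}
    (ht : 0 ≤ t) : 0 < taylorPoly α κ (truncOrder α J) t := by
  rw [taylorPoly_eq α hκ]
  have := one_le_binomPoly_truncOrder hα hn J (by positivity : 0 ≤ t / κ ^ 2)
  positivity

/-- Uniform decay of the spectral densities. -/
lemma exists_density_le (hα : 0 < α) (hn : ∀ m : ℕ, α ≠ m) {κ b : ℝ} (hκ : 0 < κ) (hb : 0 < b)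
    (σ : ℝ) : ∃ c, ∀ J, 1 ≤ J → ∀ y t : ℝ, 0 ≤ y → b * y ^ 2 ≤ t →
      |σ ^ 2 / taylorPoly α κ (truncOrder α J) t|
        ≤ c * (1 + y) ^ (-(2 * (⌊α⌋₊ + 3 : ℕ) : ℝ)) := by
  obtain ⟨c, hc, hbound⟩ := exists_le_binomPoly hα hn
  -- The half pays for (1 + y)² ≤ 2(1 + y²).
  set b' : ℝ := min 1 (b / κ ^ 2) / 2
  have hb' : 0 < b' := by positivity
  set m := ⌊α⌋₊ + 3
  have hκα : 0 < κ ^ (2 * α) := by positivity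
  refine ⟨σ ^ 2 / (κ ^ (2 * α) * (c * b' ^ m)), fun J hJ y t hy ht ↦ ?_⟩
  have ht0 : 0 ≤ t := le_trans (by positivity) ht
  rw [abs_of_nonneg (div_nonneg (sq_nonneg σ) (taylorPoly_pos hα hn hκ J ht0).le),
    show (-(2 * (m : ℕ) : ℝ)) = -((2 * m : ℕ) : ℝ) by push_cast; rfl, Real.rpow_neg (by linarith),
    Real.rpow_natCast, ← div_eq_mul_inv, div_div]
  refine div_le_div_of_nonneg_left (sq_nonneg σ) (by positivity) ?_
  rw [taylorPoly_eq α hκ, mul_assoc]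
  refine mul_le_mul_of_nonneg_left (le_trans ?_ (hbound J hJ _ (by positivity))) hκα.le
  rw [mul_assoc, pow_mul, ← mul_pow]
  refine mul_le_mul_of_nonneg_left (pow_le_pow_left₀ (by positivity) ?_ m) hc.le
  have h1 : b / κ ^ 2 * y ^ 2 ≤ t / κ ^ 2 := by
    rw [div_mul_eq_mul_div]
    gcongr
  have h2 : min 1 (b / κ ^ 2) ≤ 1 := min_le_left _ _
  have h3 : min 1 (b / κ ^ 2) ≤ b / κ ^ 2 := min_le_right _ _
  have h4 : (1 + y) ^ 2 ≤ 2 * (1 + y ^ 2) := by nlinarith [sq_nonneg (1 - y)]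
  have h5 : 0 < min 1 (b / κ ^ 2) := by positivity
  calc b' * (1 + y) ^ 2 ≤ b' * (2 * (1 + y ^ 2)) := by gcongr
    _ = min 1 (b / κ ^ 2) + min 1 (b / κ ^ 2) * y ^ 2 := by simp only [b']; ring
    _ ≤ 1 + b / κ ^ 2 * y ^ 2 := by gcongr
    _ ≤ _ := by linarith

end Taylor

/-! ### Limits of the densities as the truncation order grows. -/

section TaylorLimit

variable {α : ℝ}

lemma taylorCoeff_eq_choose (α : ℝ) (k : ℕ) : taylorCoeff α k = Ring.choose α k := by
  have h := Ring.descPochhammer_eq_factorial_smul_choose α k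
  rw [← Polynomial.aeval_eq_smeval, Polynomial.aeval_def, Polynomial.eval₂_eq_eval_map,
    descPochhammer_map, descPochhammer_eval_eq_prod_range, nsmul_eq_mul] at h
  rw [taylorCoeff, h, mul_div_cancel_left₀ _ (by positivity)]

lemma tendsto_truncOrder : Tendsto (truncOrder α) atTop atTop :=
  tendsto_atTop_mono (fun J ↦ by unfold truncOrder; rw [id]; omega) tendsto_id

lemma tendsto_binomPoly_of_lt_one {x : ℝ} (hx : 0 ≤ x) (hx1 : x < 1) :
    Tendsto (fun J ↦ binomPoly α (truncOrder α J) x) atTop (𝓝 ((1 + x) ^ α)) := by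
  have h := (Real.one_add_rpow_hasFPowerSeriesOnBall_zero (a := α)).hasSum (y := x)
    (by simpa [← ofReal_norm, abs_of_nonneg hx] using hx1)
  have h2 : HasSum (fun k ↦ taylorCoeff α k * x ^ k) ((1 + x) ^ α) := by
    simpa [-FormalMultilinearSeries.apply_eq_prod_smul_coeff, binomialSeries_apply,
      taylorCoeff_eq_choose] using h
  exact (h2.tendsto_sum_nat.comp (tendsto_add_atTop_nat 1)).comp tendsto_truncOrder

/-- The moduli u_k of successive terms have ratios tending to x > 1, and raising J adds a pair -u_k
+ u_(k+1). From some index on each pair is at least a fixed δ > 0, so the growth is at least linear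
in J. -/
lemma tendsto_binomPoly_of_one_lt (hα : 0 < α) (hn : ∀ m : ℕ, α ≠ m) {x : ℝ} (hx : 1 < x) :
    Tendsto (fun J ↦ binomPoly α (truncOrder α J) x) atTop atTop := by
  -- Any ratio strictly between 1 and x would serve.
  set y := (1 + x) / 2
  have hy : 1 < y := by simp only [y]; linarith
  have hratio : ∀ᶠ k : ℕ in atTop, y ≤ x * ((k - α) / (k + 1)) := by
    have h1 : Tendsto (fun k : ℕ ↦ x * (1 - (α + 1) * (1 / ((k : ℝ) + 1)))) atTop
        (𝓝 (x * (1 - (α + 1) * 0))) :=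
      ((tendsto_one_div_add_atTop_nhds_zero_nat.const_mul (α + 1)).const_sub 1).const_mul x
    have h2 : y < x * (1 - (α + 1) * 0) := by simp only [y]; linarith
    filter_upwards [h1.eventually_const_lt h2] with k hk
    refine hk.le.trans (le_of_eq ?_)
    have : (0 : ℝ) < (k : ℝ) + 1 := by positivity
    field_simp
    ring
  obtain ⟨k₀, hk₀⟩ := (hratio.and (eventually_ge_atTop (⌊α⌋₊ + 1))).exists_forall_of_atTop
  set u : ℕ → ℝ := fun k ↦ |taylorCoeff α k| * x ^ k
  have hu (k : ℕ) (hk : k₀ ≤ k) : y * u k ≤ u (k + 1) := by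
    have h := hk₀ k hk
    have hk' := lt_of_floor_lt h.2
    have h3 : u (k + 1) = u k * (x * ((k - α) / (k + 1))) := by
      simp only [u]
      rw [taylorCoeff_succ, abs_div, abs_mul, abs_of_neg (by linarith : α - k < 0),
        abs_of_pos (by positivity : (0 : ℝ) < (k : ℝ) + 1)]
      ring
    rw [h3, mul_comm]
    exact mul_le_mul_of_nonneg_left h.1 (by positivity)
  have hu0 (k : ℕ) : 0 ≤ u k := by positivity
  have humono (k : ℕ) (hk : k₀ ≤ k) : u k₀ ≤ u k := by
    induction k, hk using Nat.le_induction with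
    | base => rfl
    | succ k hk ih => nlinarith [hu k hk, hu0 k]
  have hupos : 0 < u k₀ := by
    have h := hk₀ k₀ le_rfl
    obtain ⟨j, hj⟩ := Nat.exists_eq_add_of_le h.2
    have h1 := neg_one_pow_mul_taylorCoeff_pos hα hn j
    rw [← hj] at h1
    have h2 : taylorCoeff α k₀ ≠ 0 := fun h0 ↦ by simp [h0] at h1
    have : 0 < x := by linarith
    positivity
  set δ := (y - 1) * u k₀
  have hδ : 0 < δ := mul_pos (by linarith) hupos
  have hstep (J : ℕ) (hJ : k₀ ≤ J) :
      binomPoly α (truncOrder α J) x + δ ≤ binomPoly α (truncOrder α (J + 1)) x := by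
    have he : truncOrder α (J + 1) = truncOrder α J + 1 + 1 := by unfold truncOrder; ring
    have hk : k₀ ≤ truncOrder α J + 1 := by unfold truncOrder; omega
    rw [binomPoly_truncOrder_succ]
    have h1 : taylorCoeff α (truncOrder α J + 1) * x ^ (truncOrder α J + 1)
        = -u (truncOrder α J + 1) := by
      simp only [u]
      rw [abs_of_neg (taylorCoeff_truncOrder_succ_neg hα hn J)]
      ring
    have h2 : taylorCoeff α (truncOrder α (J + 1)) * x ^ (truncOrder α (J + 1))
        = u (truncOrder α J + 1 + 1) := by
      rw [← he]
      simp only [u]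
      rw [abs_of_pos (taylorCoeff_truncOrder_pos hα hn _)]
    rw [h1, h2]
    have h3 := hu _ hk
    have h4 := humono _ hk
    simp only [δ]
    nlinarith
  have hlin (n : ℕ) : binomPoly α (truncOrder α k₀) x + n * δ
      ≤ binomPoly α (truncOrder α (n + k₀)) x := by
    induction n with
    | zero => simp
    | succ n ih =>
      have := hstep (n + k₀) (by omega)
      rw [Nat.add_right_comm]
      push_cast
      linarith
  rw [← tendsto_add_atTop_iff_nat k₀]
  refine tendsto_atTop_mono hlin (tendsto_atTop_add_const_left _ _ ?_)
  exact tendsto_natCast_atTop_atTop.atTop_mul_const hδ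

variable {κ : ℝ} (σ : ℝ)

lemma tendsto_density_of_lt (hκ : 0 < κ) {t : ℝ} (ht : 0 ≤ t) (htκ : t < κ ^ 2) :
    Tendsto (fun J ↦ σ ^ 2 / taylorPoly α κ (truncOrder α J) t) atTop
      (𝓝 (σ ^ 2 / (κ ^ 2 + t) ^ α)) := by
  simp only [taylorPoly_eq α hκ]
  have h1 : (κ ^ 2 + t) ^ α = κ ^ (2 * α) * (1 + t / κ ^ 2) ^ α := by
    rw [Real.rpow_mul hκ.le, Real.rpow_two, ← Real.mul_rpow (by positivity) (by positivity),
      mul_add, mul_one, mul_div_cancel₀ _ (by positivity)]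
  rw [h1]
  refine Tendsto.div tendsto_const_nhds ((tendsto_binomPoly_of_lt_one (by positivity)
    ((div_lt_one (by positivity)).2 htκ)).const_mul _) ?_
  positivity

lemma tendsto_density_of_gt (hα : 0 < α) (hn : ∀ m : ℕ, α ≠ m) (hκ : 0 < κ) {t : ℝ}
    (htκ : κ ^ 2 < t) :
    Tendsto (fun J ↦ σ ^ 2 / taylorPoly α κ (truncOrder α J) t) atTop (𝓝 0) := by
  simp only [taylorPoly_eq α hκ]
  exact ((tendsto_binomPoly_of_one_lt hα hn ((one_lt_div (by positivity)).2 htκ)).const_mul_atTop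
    (by positivity)).const_div_atTop _

end TaylorLimit
end GaussField

attribute [local instance] instMeasureSpaceUnitAddCircle instIsAddHaarMeasureUnitAddCircleVolume
  instIsProbabilityMeasureUnitAddCircleVolume

namespace GaussField

/-! ### Frequencies in the cube as points of the unit torus. -/

section Torus

variable {d : ℕ}

/-- The angles in `(-π, π]^d` of a point of the torus. -/
noncomputable def torusAngle (t : UnitAddTorus (Fin d)) : E d :=
  WithLp.toLp 2 fun p ↦ 2 * Real.pi * ((AddCircle.equivIoc 1 (-1 / 2) (t p)).1 : ℝ)

lemma measurable_torusAngle : Measurable (torusAngle (d := d)) := by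
  refine (PiLp.volume_preserving_toLp (Fin d)).measurable.comp (measurable_pi_lambda _ fun p ↦ ?_)
  exact (measurable_subtype_coe.comp ((AddCircle.measurableEquivIoc 1 (-1 / 2)).measurable.comp
    (measurable_pi_apply p))).const_mul _

lemma torusAngle_coe {x : Fin d → ℝ} (hx : ∀ p, x p ∈ Set.Ioc (-1 / 2 : ℝ) (-1 / 2 + 1)) :
    torusAngle (fun p ↦ (x p : UnitAddCircle)) = (2 * Real.pi) • WithLp.toLp 2 x := by
  ext p
  simp only [torusAngle, PiLp.smul_apply, smul_eq_mul]
  rw [AddCircle.equivIoc_coe_eq (hx p)]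

lemma coe_torusAngle (t : UnitAddTorus (Fin d)) (p : Fin d) :
    ((torusAngle t p / (2 * Real.pi) : ℝ) : UnitAddCircle) = t p := by
  have := Real.pi_pos
  simp only [torusAngle]
  rw [mul_div_cancel_left₀ _ (by positivity)]
  exact (AddCircle.equivIoc 1 (-1 / 2)).symm_apply_apply (t p)

/-- Integration over the torus uses half-open intervals; the extra faces are null. -/
lemma cube_ae_eq : cube d =ᵐ[volume] {ξ : E d | ∀ p, ξ p ∈ Set.Ioc (-Real.pi) Real.pi} := by
  have h := (PiLp.volume_preserving_ofLp (Fin d)).quasiMeasurePreserving.ae_eq_comp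
    (Measure.pi_Ioo_ae_eq_pi_Ioc (μ := fun _ : Fin d ↦ (volume : Measure ℝ)) (s := Set.univ)
    (f := fun _ ↦ -Real.pi) (g := fun _ ↦ Real.pi))
  have e : ∀ S : Set ℝ, (Set.univ.pi fun _ ↦ S) ∘ (WithLp.ofLp : E d → Fin d → ℝ) =
      {ξ : E d | ∀ p, ξ p ∈ S} := fun S ↦ by
    funext ξ
    simp [Set.pi, Set.ofPred]
  rw [e, e] at h
  exact h

lemma measurableSet_cube : MeasurableSet (cube d) := by
  have : cube d = ⋂ p, {ξ : E d | ξ p ∈ Set.Ioo (-Real.pi) Real.pi} := by ext; simp [cube]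
  rw [this]
  refine MeasurableSet.iInter fun p ↦ ?_
  exact (by fun_prop : Measurable fun ξ : E d ↦ ξ p) measurableSet_Ioo

/-- The normalisation (2π)^(-d) is the Jacobian between torus and cube, so `invFourier` of a density
on the cube is an average over the torus. -/
lemma integral_comp_torusAngle (g : E d → ℂ) :
    ∫ t, g (torusAngle t) = ((2 * Real.pi : ℝ) ^ d : ℂ)⁻¹ * ∫ ξ, (cube d).indicator g ξ := by
  have hpi := Real.pi_pos
  set Q : Set (E d) := {ξ : E d | ∀ p, ξ p ∈ Set.Ioc (-Real.pi) Real.pi} with hQ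
  have hm : MeasurableSet {x : Fin d → ℝ | ∀ i, x i ∈ Set.Ioc (-1 / 2 : ℝ) (-1 / 2 + 1)} :=
    MeasurableSet.univ_pi' fun _ ↦ measurableSet_Ioc
  have h1 : (cube d).indicator g =ᵐ[volume] Q.indicator g := indicator_ae_eq_of_ae_eq_set cube_ae_eq
  rw [UnitAddTorus.integral_preimage _ (fun _ ↦ -1 / 2), integral_congr_ae h1,
    ← integral_indicator hm]
  have h2 : ({x : Fin d → ℝ | ∀ i, x i ∈ Set.Ioc (-1 / 2 : ℝ) (-1 / 2 + 1)}.indicator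
      fun x ↦ g (torusAngle fun p ↦ (x p : UnitAddCircle))) =
      fun x ↦ Q.indicator g ((2 * Real.pi) • WithLp.toLp 2 x) := by
    funext x
    have hiff : (2 * Real.pi) • WithLp.toLp 2 x ∈ Q ↔
        x ∈ {x : Fin d → ℝ | ∀ i, x i ∈ Set.Ioc (-1 / 2 : ℝ) (-1 / 2 + 1)} := by
      simp only [hQ, Set.mem_ofPred_eq, PiLp.smul_apply, smul_eq_mul, Set.mem_Ioc]
      refine forall_congr' fun p ↦ and_congr ?_ ?_ <;>
        constructor <;> intro h <;> nlinarith
    by_cases hx : x ∈ {x : Fin d → ℝ | ∀ i, x i ∈ Set.Ioc (-1 / 2 : ℝ) (-1 / 2 + 1)}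
    · rw [Set.indicator_of_mem hx, Set.indicator_of_mem (hiff.2 hx), torusAngle_coe hx]
    · rw [Set.indicator_of_notMem hx, Set.indicator_of_notMem (mt hiff.1 hx)]
  rw [h2]
  rw [(PiLp.volume_preserving_toLp (Fin d)).integral_comp
    (MeasurableEquiv.toLp 2 _).measurableEmbedding (fun ξ ↦ Q.indicator g ((2 * Real.pi) • ξ)),
    Measure.integral_comp_smul]
  rw [finrank_euclideanSpace_fin, abs_of_nonneg (by positivity)]
  simp

/-- The exponential `exp(-i y·θ)` as a function of the angles `θ ∈ (-π, π]^d`. -/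
noncomputable def torusExp (y : E d) (t : UnitAddTorus (Fin d)) : ℂ :=
  Complex.exp (-(Complex.I * ((inner ℝ y (torusAngle t) : ℝ) : ℂ)))

lemma norm_torusExp (y : E d) (t : UnitAddTorus (Fin d)) : ‖torusExp y t‖ = 1 := by
  rw [torusExp, ← mul_neg, mul_comm, ← Complex.ofReal_neg, Complex.norm_exp_ofReal_mul_I]

lemma measurable_torusExp (y : E d) : Measurable (torusExp y) := by
  have := measurable_torusAngle (d := d)
  unfold torusExp
  fun_prop

lemma torusExp_add (x y : E d) (t : UnitAddTorus (Fin d)) :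
    torusExp (x + y) t = torusExp x t * torusExp y t := by
  rw [torusExp, torusExp, torusExp, ← Complex.exp_add, inner_add_left]
  push_cast
  ring_nf

lemma conj_torusExp (y : E d) (t : UnitAddTorus (Fin d)) :
    (starRingEnd ℂ) (torusExp y t) = torusExp (-y) t := by
  rw [torusExp, torusExp, ← Complex.exp_conj]
  simp

lemma torusExp_eq_prod (y : E d) (t : UnitAddTorus (Fin d)) :
    torusExp y t = ∏ p, Complex.exp (-(Complex.I * (y p * torusAngle t p : ℝ))) := by
  rw [torusExp, ← Complex.exp_sum, PiLp.inner_apply]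
  simp [Finset.mul_sum, mul_comm]

/-- The sign reconciles the kernel exp(-i x·ξ) with the convention of the Fourier monomials. -/
lemma mFourier_neg_eq_torusExp (j : Fin d → ℤ) (t : UnitAddTorus (Fin d)) :
    UnitAddTorus.mFourier (-j) t = torusExp (intVec j) t := by
  have := Real.pi_pos.ne'
  rw [torusExp_eq_prod, UnitAddTorus.mFourier, ContinuousMap.coe_mk]
  refine Finset.prod_congr rfl fun p _ ↦ ?_
  rw [← coe_torusAngle t p, fourier_coe_apply]
  congr 1
  simp only [intVec, Pi.neg_apply]
  push_cast
  field_simp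

lemma intervalIntegral_exp (y : ℝ) :
    ∫ x in (-1 / 2 : ℝ)..(-1 / 2 + 1), Complex.exp (-(Complex.I * (y * (2 * Real.pi * x) : ℝ))) =
      (Real.sinc (Real.pi * y) : ℂ) := by
  have hpi := Real.pi_pos.ne'
  rcases eq_or_ne y 0 with rfl | hy
  · simp
  have hy' : (y : ℂ) ≠ 0 := by exact_mod_cast hy
  have hpi' : (Real.pi : ℂ) ≠ 0 := by exact_mod_cast hpi
  have hc : -(Complex.I * (y * (2 * Real.pi))) ≠ (0 : ℂ) := by simp [hy, hpi]
  have h1 : ∀ x : ℝ, -(Complex.I * (y * (2 * Real.pi * x) : ℝ)) =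
      -(Complex.I * (y * (2 * Real.pi))) * (x : ℂ) := fun x ↦ by push_cast; ring
  simp_rw [h1]
  rw [integral_exp_mul_complex hc, Real.sinc_of_ne_zero (by positivity)]
  push_cast
  rw [Complex.sin, div_eq_div_iff hc (by simp [hy, hpi])]
  have e1 : -(Complex.I * (y * (2 * Real.pi))) * (-1 / 2 + 1 : ℂ) = -(Real.pi * y) * Complex.I := by
    ring
  have e2 : -(Complex.I * (y * (2 * Real.pi))) * (-1 / 2 : ℂ) = (Real.pi * y) * Complex.I := by
    ring
  rw [e1, e2]
  linear_combination (Real.pi * y * (Complex.exp (Real.pi * y * Complex.I) -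
    Complex.exp (-(Real.pi * y) * Complex.I))) * (-Complex.I_sq)

lemma integral_torusExp (y : E d) :
    ∫ t, torusExp y t = ((∏ p, Real.sinc (Real.pi * y p) : ℝ) : ℂ) := by
  simp_rw [torusExp_eq_prod]
  have h := MeasureTheory.integral_fintype_prod_volume_eq_prod (ι := Fin d)
    (E := fun _ ↦ UnitAddCircle)
    (fun p (u : UnitAddCircle) ↦ Complex.exp
      (-(Complex.I * (y p * (2 * Real.pi * ((AddCircle.equivIoc 1 (-1 / 2) u).1 : ℝ)) : ℝ))))
  refine h.trans ?_
  push_cast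
  refine Finset.prod_congr rfl fun p _ ↦ ?_
  have h2 := fourierCoeff_eq_intervalIntegral (T := 1) (fun u : UnitAddCircle ↦ Complex.exp
      (-(Complex.I * (y p * (2 * Real.pi * ((AddCircle.equivIoc 1 (-1 / 2) u).1 : ℝ)) : ℝ))))
      0 (-1 / 2)
  simp only [fourierCoeff, neg_zero, fourier_zero, one_smul, div_one] at h2
  refine (Eq.trans ?_ h2).trans ?_
  · push_cast
    rfl
  rw [← intervalIntegral_exp]
  refine intervalIntegral.integral_congr_ae (ae_of_all _ fun x hx ↦ ?_)
  rw [Set.uIoc_of_le (by norm_num)] at hx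
  rw [AddCircle.equivIoc_coe_eq hx]

end Torus

end GaussField

namespace GaussField

/-! ### The sampling theorem in L² of the torus. -/

section SincSeries

variable {d : ℕ}

lemma memLp_torusExp (y : E d) : MemLp (torusExp y) 2 :=
  MemLp.of_bound (measurable_torusExp y).aestronglyMeasurable 1
    (ae_of_all _ fun t ↦ (norm_torusExp y t).le)

/-- `torusExp y` as an element of `L²`. -/
noncomputable def torusExpLp (y : E d) : Lp ℂ 2 (volume : Measure (UnitAddTorus (Fin d))) :=
  (memLp_torusExp y).toLp

lemma torusExpLp_intVec (j : Fin d → ℤ) :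
    torusExpLp (intVec j) = UnitAddTorus.mFourierLp 2 (-j) := by
  refine Lp.ext ?_
  filter_upwards [(memLp_torusExp (intVec j)).coeFn_toLp, UnitAddTorus.coeFn_mFourierLp 2 (-j)]
    with t h1 h2
  rw [h2, torusExpLp, h1, mFourier_neg_eq_torusExp]

/-- This is the origin of the interpolation kernel: sinc products are the Fourier coefficients of
exponentials of real frequency. -/
lemma mFourierCoeff_torusExpLp (y : E d) (j : Fin d → ℤ) :
    UnitAddTorus.mFourierCoeff (torusExpLp y) (-j) =
      ((∏ p, Real.sinc (Real.pi * (y p - j p)) : ℝ) : ℂ) := by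
  have h : ∀ p, y p - j p = (intVec (-j) + y : E d) p := fun p ↦ by
    simp [intVec]; ring
  simp_rw [h]
  rw [← integral_torusExp, UnitAddTorus.mFourierCoeff]
  refine integral_congr_ae ?_
  filter_upwards [(memLp_torusExp y).coeFn_toLp] with t ht
  rw [torusExpLp, ht, mFourier_neg_eq_torusExp, torusExp_add, smul_eq_mul]

/-- Sampling theorem in vector form; the interpolation of covariances and of fields both arise by
applying bounded maps to this Fourier series. -/
lemma hasSum_torusExpLp (y : E d) :
    HasSum (fun j : Fin d → ℤ ↦
      ((∏ p, Real.sinc (Real.pi * (y p - j p)) : ℝ) : ℂ) • torusExpLp (intVec j))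
      (torusExpLp y) := by
  have h := (Equiv.neg (Fin d → ℤ)).hasSum_iff.2
    (UnitAddTorus.hasSum_mFourier_series_L2 (torusExpLp y))
  simpa only [Function.comp_def, Equiv.neg_apply, mFourierCoeff_torusExpLp, ← torusExpLp_intVec]
    using h

variable {s : E d → ℝ} {c : ℝ}

lemma memLp_weight (hs : Measurable s) (hb : ∀ ξ, |s ξ| ≤ c) :
    MemLp (fun t : UnitAddTorus (Fin d) ↦ (s (torusAngle t) : ℂ)) ⊤ := by
  have := measurable_torusAngle (d := d)
  exact memLp_top_of_bound (Complex.measurable_ofReal.comp (hs.comp this)).aestronglyMeasurable c (ae_of_all _ fun t ↦ by simpa using hb _)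

/-- Multiplication by a bounded function of the angles, as an operator on `L²` of the torus. -/
noncomputable def weightOp (hs : Measurable s) (hb : ∀ ξ, |s ξ| ≤ c) :
    Lp ℂ 2 (volume : Measure (UnitAddTorus (Fin d))) →L[ℂ]
      Lp ℂ 2 (volume : Measure (UnitAddTorus (Fin d))) :=
  (ContinuousLinearMap.mul ℂ ℂ).holderL volume ⊤ 2 2 (memLp_weight hs hb).toLp

/-- Covariances at lattice points and at real points become matrix elements of one bounded operator.
-/
lemma inner_weightOp (hs : Measurable s) (hb : ∀ ξ, |s ξ| ≤ c) (x y : E d) :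
    inner ℂ (torusExpLp y) (weightOp hs hb (torusExpLp x)) =
      invFourier ((cube d).indicator s) (x - y) := by
  have h1 : inner ℂ (torusExpLp y) (weightOp hs hb (torusExpLp x)) =
      ∫ t, torusExp (x - y) t * (s (torusAngle t) : ℂ) := by
    rw [L2.inner_def]
    refine integral_congr_ae ?_
    filter_upwards [(memLp_torusExp y).coeFn_toLp, (memLp_torusExp x).coeFn_toLp,
      (memLp_weight hs hb).coeFn_toLp,
      ContinuousLinearMap.coeFn_holder (r := 2) (ContinuousLinearMap.mul ℂ ℂ)
        (memLp_weight hs hb).toLp (torusExpLp x)] with t h1 h2 h3 h4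
    have h5 : (weightOp hs hb (torusExpLp x)) t = s (torusAngle t) * torusExp x t := by
      rw [weightOp, ContinuousLinearMap.holderL_apply_apply, h4, h3, torusExpLp, h2]
      rfl
    rw [h5, RCLike.inner_apply, torusExpLp, h1, conj_torusExp, sub_eq_add_neg, torusExp_add]
    ring
  rw [h1, invFourier]
  refine (integral_comp_torusAngle
    (fun ξ ↦ Complex.exp (-(Complex.I * ((inner ℝ (x - y) ξ : ℝ) : ℂ))) * (s ξ : ℂ))).trans ?_
  congr 2
  funext ξ
  by_cases hξ : ξ ∈ cube d <;> simp [hξ]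

/-- The Whittaker–Shannon interpolation of a band-limited stationary covariance function. -/
lemma hasSum_invFourier_sinc (hs : Measurable s) (hb : ∀ ξ, |s ξ| ≤ c) (x : E d) :
    HasSum (fun j : Fin d → ℤ ↦ (invFourier ((cube d).indicator s) (intVec j)).re *
      ∏ p, Real.sinc (Real.pi * (x p - j p))) (invFourier ((cube d).indicator s) x).re := by
  have h := Complex.hasSum_re (((innerSL ℂ (torusExpLp (0 : E d))).comp (weightOp hs hb)).hasSum
    (hasSum_torusExpLp x))
  simp only [ContinuousLinearMap.comp_apply, innerSL_apply_apply, map_smul, smul_eq_mul,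
    inner_weightOp, sub_zero, Complex.re_ofReal_mul] at h
  simpa only [mul_comm] using h

end SincSeries

/-! ### Series in a Gaussian Hilbert space. -/

section HilbertInterpolation

variable {ι Ω H : Type*} [MeasurableSpace Ω] {μ : Measure Ω}
  [NormedAddCommGroup H] [InnerProductSpace ℂ H] {Z : ι → Ω → ℝ} {V : ι → H} {W : H →L[ℂ] H}

lemma sum_mul_inner_eq (F G : Finset ι) (a b : ι → ℝ) :
    ∑ i ∈ F, ∑ j ∈ G, a i * b j * (inner ℂ (V j) (W (V i))).re =
      (inner ℂ (∑ j ∈ G, (b j : ℂ) • V j) (W (∑ i ∈ F, (a i : ℂ) • V i))).re := by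
  simp only [map_sum, map_smul, sum_inner, inner_sum, inner_smul_left, inner_smul_right,
    Complex.re_sum, Complex.conj_ofReal, Complex.re_ofReal_mul]
  refine Finset.sum_congr rfl fun i _ ↦ ?_
  rw [Finset.mul_sum]
  exact Finset.sum_congr rfl fun j _ ↦ by ring

lemma IsCentredGaussianField.memLp_linComb {K : ι → ι → ℝ} (h : IsCentredGaussianField Z μ K)
    (F : Finset ι) (a : ι → ℝ) : MemLp (linComb Z F a) 2 μ :=
  (h.hasGaussianLaw_linComb F a).memLp_two

/-- The variance of a combination is the quadratic form of W at the same combination of the V i, so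
V i ↦ Z i acts as a bounded map into L². -/
lemma IsCentredGaussianField.norm_linComb_le
    (h : IsCentredGaussianField Z μ fun i j ↦ (inner ℂ (V j) (W (V i))).re)
    (F : Finset ι) (a : ι → ℝ) :
    ‖(h.memLp_linComb F a).toLp‖ ^ 2 ≤ ‖W‖ * ‖∑ i ∈ F, (a i : ℂ) • V i‖ ^ 2 := by
  set g := ∑ i ∈ F, (a i : ℂ) • V i
  have h1 : ‖(h.memLp_linComb F a).toLp‖ ^ 2 = (inner ℂ g (W g)).re := by
    rw [← sum_mul_inner_eq, ← h.covariance_linComb,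
      covariance_self (h.memLp_linComb F a).aestronglyMeasurable.aemeasurable,
      variance_of_integral_eq_zero (h.memLp_linComb F a).aestronglyMeasurable.aemeasurable
        (h.integral_linComb F a), ← real_inner_self_eq_norm_sq, L2.inner_def]
    refine integral_congr_ae ?_
    filter_upwards [(h.memLp_linComb F a).coeFn_toLp] with ω hω
    rw [hω, real_inner_self_eq_norm_sq, Real.norm_eq_abs, sq_abs]
  rw [h1]
  calc (inner ℂ g (W g)).re ≤ ‖inner ℂ g (W g)‖ := Complex.re_le_norm _
    _ ≤ ‖g‖ * ‖W g‖ := norm_inner_le_norm _ _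
    _ ≤ ‖g‖ * (‖W‖ * ‖g‖) := by gcongr; exact W.le_opNorm g
    _ = _ := by ring

lemma IsCentredGaussianField.toLp_linComb {K : ι → ι → ℝ} (h : IsCentredGaussianField Z μ K)
    (F : Finset ι) (a : ι → ℝ) :
    (h.memLp_linComb F a).toLp = ∑ i ∈ F, a i • (h.memLp i).toLp := by
  classical
  induction F using Finset.induction_on with
  | empty =>
    simp only [Finset.sum_empty]
    exact MemLp.toLp_zero _
  | insert i F hi ih =>
    rw [Finset.sum_insert hi, ← ih, ← MemLp.toLp_const_smul, ← MemLp.toLp_add]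
    congr 1
    funext ω
    simp [linComb, Finset.sum_insert hi]

/-- A series in a Gaussian Hilbert space converges as soon as it converges in a Hilbert space
which represents the covariances. -/
theorem IsCentredGaussianField.exists_tendsto_linComb
    (h : IsCentredGaussianField Z μ fun i j ↦ (inner ℂ (V j) (W (V i))).re) {a : ι → ℝ} {u : H}
    (hu : HasSum (fun i ↦ (a i : ℂ) • V i) u) :
    ∃ X : Ω → ℝ, MemLp X 2 μ ∧
      Tendsto (fun F : Finset ι ↦ eLpNorm (fun ω ↦ X ω - linComb Z F a ω) 2 μ) atTop (𝓝 0) := by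
  have hsum : Summable fun i ↦ a i • (h.memLp i).toLp := by
    refine summable_iff_vanishing_norm.2 fun ε hε ↦ ?_
    -- The radius works because ‖W‖ < (‖W‖ + 1)².
    obtain ⟨s, hs⟩ := hu.summable.vanishing
      (Metric.ball_mem_nhds 0 (by positivity : 0 < ε / (‖W‖ + 1)))
    refine ⟨s, fun t ht ↦ ?_⟩
    rw [← h.toLp_linComb]
    refine lt_of_pow_lt_pow_left₀ 2 hε.le ((h.norm_linComb_le t a).trans_lt ?_)
    have h1 := mem_ball_zero_iff.1 (hs t ht)
    have hW := norm_nonneg W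
    rw [lt_div_iff₀ (by positivity)] at h1
    have h2 := pow_lt_pow_left₀ h1 (by positivity) two_ne_zero
    nlinarith [sq_nonneg ‖∑ i ∈ t, (a i : ℂ) • V i‖,
      mul_nonneg (sq_nonneg ‖∑ i ∈ t, (a i : ℂ) • V i‖) hW,
      mul_nonneg (sq_nonneg ‖∑ i ∈ t, (a i : ℂ) • V i‖) (sq_nonneg ‖W‖)]
  obtain ⟨X, hX⟩ := hsum
  refine ⟨X, Lp.memLp X, ?_⟩
  have h1 := (Lp.tendsto_Lp_iff_tendsto_eLpNorm' _ _).1 hX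
  refine h1.congr fun F ↦ ?_
  rw [← h.toLp_linComb, eLpNorm_sub_comm]
  refine eLpNorm_congr_ae ?_
  filter_upwards [(h.memLp_linComb F a).coeFn_toLp] with ω hω
  simp [hω]

/-- Partial sums over a finite set are jointly Gaussian in x, with inner products of partial sums as
covariances; these converge by continuity, and mean square limits stay Gaussian. -/
theorem IsCentredGaussianField.of_tendsto_linComb [IsProbabilityMeasure μ] {T : Type*}
    (h : IsCentredGaussianField Z μ fun i j ↦ (inner ℂ (V j) (W (V i))).re) {a : T → ι → ℝ}
    {U : T → H} (hU : ∀ x, HasSum (fun i ↦ (a x i : ℂ) • V i) (U x)) {X : T → Ω → ℝ}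
    (hX : ∀ x, MemLp (X x) 2 μ) (hlim : ∀ x, Tendsto
      (fun F : Finset ι ↦ eLpNorm (fun ω ↦ X x ω - linComb Z F (a x) ω) 2 μ) atTop (𝓝 0)) :
    IsCentredGaussianField X μ fun x y ↦ (inner ℂ (U y) (W (U x))).re := by
  refine IsCentredGaussianField.of_tendsto_eLpNorm (l := (atTop : Filter (Finset ι)))
    (Y := fun F x ↦ linComb Z F (a x))
    (K := fun F x y ↦ (inner ℂ (∑ j ∈ F, (a y j : ℂ) • V j)
      (W (∑ i ∈ F, (a x i : ℂ) • V i))).re) (fun F ↦ ⟨?_, fun t ↦ h.integral_linComb F _, fun x y ↦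
        by rw [h.covariance_linComb, sum_mul_inner_eq]⟩) (fun x y ↦ ?_) hX hlim
  · refine ⟨fun I ↦ ?_⟩
    have h1 := (h.gaussian.hasGaussianLaw F).map (ContinuousLinearMap.pi fun x : I ↦
      ∑ i : F, a x i • ContinuousLinearMap.proj (R := ℝ) (φ := fun _ : F ↦ ℝ) i)
    refine h1.congr (ae_of_all _ fun ω ↦ funext fun x ↦ ?_)
    simp [linComb, ← Finset.sum_coe_sort F]
  · exact (Complex.continuous_re.tendsto _).comp
      (Tendsto.inner (hU y) ((W.continuous.tendsto _).comp (hU x)))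

end HilbertInterpolation

end GaussField

namespace GaussField

/-! ### Lattice fields, their interpolation, and the two Matérn limits. -/

section Lattice

variable {d : ℕ} {α κ σ h : ℝ} {J : ℕ}

/-- The spectral density of the lattice field, as a function on `ℝ^d`. -/
noncomputable def latticeDensity (d : ℕ) (α κ σ : ℝ) (K : ℕ) (h : ℝ) (ξ : E d) : ℝ :=
  σ ^ 2 / (h ^ d * taylorPoly α κ K (laplaceSymbol h ξ))

@[fun_prop]
lemma continuous_taylorPoly (α κ : ℝ) (K : ℕ) : Continuous (taylorPoly α κ K) := by
  unfold taylorPoly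
  fun_prop

@[fun_prop]
lemma continuous_laplaceSymbol (h : ℝ) : Continuous (laplaceSymbol (d := d) h) := by
  unfold laplaceSymbol
  fun_prop

lemma laplaceSymbol_nonneg (h : ℝ) (ξ : E d) : 0 ≤ laplaceSymbol h ξ :=
  Finset.sum_nonneg fun p _ ↦ div_nonneg (by linarith [Real.cos_le_one (ξ p)]) (sq_nonneg h)

lemma measurable_latticeDensity (K : ℕ) : Measurable (latticeDensity d α κ σ K h) := by
  unfold latticeDensity
  have := (continuous_taylorPoly α κ K).comp (continuous_laplaceSymbol (d := d) h)
  exact measurable_const.div (this.measurable.const_mul _)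

lemma exists_latticeDensity_le (hα : 0 < α) (hn : ∀ m : ℕ, α ≠ m) (hκ : 0 < κ) (σ : ℝ)
    (hJ : 1 ≤ J) (hh : 0 < h) :
    ∃ c, ∀ ξ, |latticeDensity d α κ σ (truncOrder α J) h ξ| ≤ c := by
  obtain ⟨c, hc⟩ := exists_density_le hα hn hκ one_pos σ
  refine ⟨(h ^ d)⁻¹ * c, fun ξ ↦ ?_⟩
  have h1 := hc J hJ 0 (laplaceSymbol h ξ) le_rfl (by simpa using laplaceSymbol_nonneg h ξ)
  simp only [add_zero, Real.one_rpow, mul_one] at h1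
  rw [latticeDensity, mul_comm (h ^ d), ← div_div, div_eq_inv_mul, abs_mul,
    abs_of_nonneg (by positivity)]
  gcongr

lemma sincKernel_eq (h : ℝ) (j : Fin d → ℤ) (x : E d) :
    sincKernel h j x = ∏ p, Real.sinc (Real.pi * ((h⁻¹ • x) p - j p)) := by
  simp only [sincKernel, PiLp.smul_apply, smul_eq_mul, div_eq_inv_mul]

lemma hasSum_latticeCov_mul_sincKernel (hα : 0 < α) (hn : ∀ m : ℕ, α ≠ m) (hκ : 0 < κ) (σ : ℝ)
    (hJ : 1 ≤ J) (hh : 0 < h) (x : E d) :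
    HasSum (fun j ↦ latticeCov α κ σ (truncOrder α J) h j * sincKernel h j x)
      (invFourier ((cube d).indicator (latticeDensity d α κ σ (truncOrder α J) h)) (h⁻¹ • x)).re := by
  obtain ⟨c, hc⟩ := exists_latticeDensity_le (d := d) hα hn hκ σ hJ hh
  simp_rw [sincKernel_eq]
  exact hasSum_invFourier_sinc (measurable_latticeDensity _) hc (h⁻¹ • x)

lemma interpolatedCov_eq (hα : 0 < α) (hn : ∀ m : ℕ, α ≠ m) (hκ : 0 < κ) (σ : ℝ)
    (hJ : 1 ≤ J) (hh : 0 < h) (x : E d) :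
    interpolatedCov α κ σ (truncOrder α J) h x =
      (invFourier ((cube d).indicator (latticeDensity d α κ σ (truncOrder α J) h)) (h⁻¹ • x)).re :=
  (hasSum_latticeCov_mul_sincKernel hα hn hκ σ hJ hh x).tsum_eq

/-- Lattice values correspond to the vectors `torusExpLp (intVec j)` and the interpolated value at x
to `torusExpLp (h⁻¹ • x)`, whose expansion has the kernel values as coefficients. -/
theorem whittakerShannon_interpolation (hα : 0 < α) (hn : ∀ m : ℕ, α ≠ m) (hκ : 0 < κ) (σ : ℝ)
    (hJ : 1 ≤ J) (hh : 0 < h) {Ω : Type*} [MeasurableSpace Ω] (μ : Measure Ω)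
    [IsProbabilityMeasure μ] (Z : (Fin d → ℤ) → Ω → ℝ)
    (hZ : IsCentredGaussianField Z μ fun i j ↦ latticeCov α κ σ (truncOrder α J) h (i - j)) :
    (∃ X : E d → Ω → ℝ, IsWhittakerShannonInterpolation h Z X μ) ∧
      ∀ X : E d → Ω → ℝ, IsWhittakerShannonInterpolation h Z X μ →
        IsCentredGaussianField X μ
          fun x y ↦ interpolatedCov α κ σ (truncOrder α J) h (x - y) := by
  obtain ⟨c, hc⟩ := exists_latticeDensity_le (d := d) hα hn hκ σ hJ hh
  have hs : Measurable (latticeDensity d α κ σ (truncOrder α J) h) := measurable_latticeDensity _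
  have hZ' : IsCentredGaussianField Z μ fun i j ↦
      (inner ℂ (torusExpLp (intVec j)) (weightOp hs hc (torusExpLp (intVec i)))).re := by
    convert hZ using 3 with i j
    rw [inner_weightOp, latticeCov]
    congr 3
    ext p
    simp [intVec]
  have hV (x : E d) : HasSum (fun j : Fin d → ℤ ↦
      (sincKernel h j x : ℂ) • torusExpLp (intVec j)) (torusExpLp (h⁻¹ • x)) := by
    simp_rw [sincKernel_eq]
    exact hasSum_torusExpLp _
  refine ⟨?_, fun X hX ↦ ?_⟩
  · choose X hX hlim using fun x ↦ hZ'.exists_tendsto_linComb (hV x)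
    exact ⟨X, fun x ↦ ⟨hX x, hlim x⟩⟩
  · convert hZ'.of_tendsto_linComb hV (fun x ↦ (hX x).1) (fun x ↦ (hX x).2) using 3 with x y
    rw [interpolatedCov_eq hα hn hκ σ hJ hh, inner_weightOp, smul_sub]

/-- The spectral density of the interpolated lattice field. -/
noncomputable def interpolatedDensity (d : ℕ) (α κ σ : ℝ) (K : ℕ) (h : ℝ) : E d → ℝ :=
  {ξ : E d | h • ξ ∈ cube d}.indicator fun ξ ↦ σ ^ 2 / taylorPoly α κ K (laplaceSymbol h (h • ξ))

/-- Substituting hξ for ξ spreads the cube to (-π/h, π/h)^d, and the Jacobian h^d cancels the factor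
h^(-d) of the lattice density. -/
lemma invFourier_inv_smul (hh : 0 < h) (K : ℕ) (x : E d) :
    invFourier ((cube d).indicator (latticeDensity d α κ σ K h)) (h⁻¹ • x) =
      invFourier (interpolatedDensity d α κ σ K h) x := by
  rw [invFourier, invFourier]
  congr 1
  have h1 := Measure.integral_comp_smul (volume : Measure (E d)) (fun ξ ↦
    Complex.exp (-(Complex.I * ((inner ℝ (h⁻¹ • x) ξ : ℝ) : ℂ))) *
      (((cube d).indicator (latticeDensity d α κ σ K h) ξ : ℝ) : ℂ)) h
  rw [finrank_euclideanSpace_fin, abs_of_nonneg (by positivity),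
    eq_inv_smul_iff₀ (by positivity), ← integral_smul] at h1
  rw [← h1]
  congr 1
  funext ξ
  have e1 : inner ℝ (h⁻¹ • x) (h • ξ) = inner ℝ x ξ := by
    rw [real_inner_smul_left, real_inner_smul_right, inv_mul_cancel_left₀ hh.ne']
  have e2 : interpolatedDensity d α κ σ K h ξ =
      h ^ d * (cube d).indicator (latticeDensity d α κ σ K h) (h • ξ) := by
    by_cases hξ : h • ξ ∈ cube d
    · rw [interpolatedDensity, Set.indicator_of_mem (by exact hξ), Set.indicator_of_mem hξ,
        latticeDensity, ← mul_div_assoc, mul_div_mul_left _ _ (by positivity)]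
    · rw [interpolatedDensity, Set.indicator_of_notMem (by exact hξ), Set.indicator_of_notMem hξ,
        mul_zero]
  rw [e1, e2, Complex.real_smul]
  push_cast
  ring

lemma two_sub_two_mul_cos (x : ℝ) : 2 - 2 * Real.cos x = 4 * Real.sin (x / 2) ^ 2 := by
  have h1 := Real.cos_sq' (x / 2)
  have h2 := Real.cos_two_mul (x / 2)
  rw [mul_div_cancel₀ _ two_ne_zero] at h2
  linarith

/-- Each coordinate contributes 4 sin²(hξ_p/2)/h², and Jordan's inequality |sin u| ≥ 2|u|/π applies
since the cube gives |hξ_p/2| ≤ π/2. The constant does not depend on h, as domination requires. -/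
lemma laplaceSymbol_smul_ge (hh : 0 < h) {ξ : E d} (hξ : h • ξ ∈ cube d) :
    4 / Real.pi ^ 2 * ‖ξ‖ ^ 2 ≤ laplaceSymbol h (h • ξ) := by
  rw [EuclideanSpace.real_norm_sq_eq, laplaceSymbol, Finset.mul_sum]
  refine Finset.sum_le_sum fun p _ ↦ ?_
  have h1 := hξ p
  have h2 := Real.mul_abs_le_abs_sin (x := (h • ξ) p / 2)
    (by rw [abs_le]; constructor <;> linarith [h1.1, h1.2])
  have h3 := pow_le_pow_left₀ (by positivity) h2 2
  rw [mul_pow, sq_abs, sq_abs] at h3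
  rw [two_sub_two_mul_cos, le_div_iff₀ (by positivity)]
  rw [PiLp.smul_apply, smul_eq_mul] at h3 ⊢
  have e : 4 / Real.pi ^ 2 * ξ p ^ 2 * h ^ 2 =
      4 * ((2 / Real.pi) ^ 2 * (h * ξ p / 2) ^ 2) := by ring
  linarith

lemma tendsto_laplaceSymbol_smul {h : ℕ → ℝ} (hpos : ∀ n, 0 < h n) (hh : Tendsto h atTop (𝓝 0))
    (ξ : E d) : Tendsto (fun n ↦ laplaceSymbol (h n) (h n • ξ)) atTop (𝓝 (‖ξ‖ ^ 2)) := by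
  have e (n : ℕ) : laplaceSymbol (h n) (h n • ξ) =
      ∑ p, ξ p ^ 2 * Real.sinc (h n * ξ p / 2) ^ 2 := by
    refine Finset.sum_congr rfl fun p _ ↦ ?_
    have := (hpos n).ne'
    rw [PiLp.smul_apply, smul_eq_mul, two_sub_two_mul_cos]
    rcases eq_or_ne (ξ p) 0 with h0 | h0
    · simp [h0]
    · rw [Real.sinc_of_ne_zero (by positivity)]
      field_simp
      ring
  simp_rw [e, EuclideanSpace.real_norm_sq_eq]
  refine tendsto_finsetSum _ fun p _ ↦ ?_
  have h1 : Tendsto (fun n ↦ h n * ξ p / 2) atTop (𝓝 0) := by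
    simpa using (hh.mul_const (ξ p)).div_const 2
  have h2 := (Real.continuous_sinc.tendsto 0).comp h1
  rw [Real.sinc_zero] at h2
  simpa using (h2.pow 2).const_mul (ξ p ^ 2)

lemma eventually_smul_mem_cube {h : ℕ → ℝ} (hh : Tendsto h atTop (𝓝 0)) (ξ : E d) :
    ∀ᶠ n in atTop, h n • ξ ∈ cube d := by
  simp only [cube, Set.mem_ofPred_eq, PiLp.smul_apply, smul_eq_mul]
  refine eventually_all.2 fun p ↦ ?_
  have h1 := hh.mul_const (ξ p)
  rw [zero_mul] at h1
  exact h1 (Ioo_mem_nhds (by linarith [Real.pi_pos]) Real.pi_pos)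

/-- Since ⌊α⌋ + 1 > α > d/2, the exponent even exceeds d + 4. -/
lemma dim_add_one_lt (hα : (d : ℝ) / 2 < α) : (d : ℝ) + 1 < 2 * (⌊α⌋₊ + 3 : ℕ) := by
  have := Nat.lt_floor_add_one α
  push_cast
  linarith

/-- Every frequency eventually lies in the growing cubes, where the symbol tends to |ξ|²;
`exists_density_le` with b = 4/π² dominates the densities. -/
theorem convergesWeaklyToGaussian_interpolated (hα : (d : ℝ) / 2 < α) (hn : ∀ m : ℕ, α ≠ m)
    (hκ : 0 < κ) (σ : ℝ) (hJ : 1 ≤ J) {Ω : ℕ → Type*} [∀ n, MeasurableSpace (Ω n)]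
    {μ : ∀ n, Measure (Ω n)} [∀ n, IsProbabilityMeasure (μ n)] {X : ∀ n, E d → Ω n → ℝ}
    {h : ℕ → ℝ} (hpos : ∀ n, 0 < h n) (hh : Tendsto h atTop (𝓝 0))
    (hX : ∀ n, IsCentredGaussianField (X n) (μ n)
      fun x y ↦ interpolatedCov α κ σ (truncOrder α J) (h n) (x - y)) :
    ConvergesWeaklyToGaussian X μ fun x y ↦ truncatedCov α κ σ (truncOrder α J) (x - y) := by
  have hα0 : 0 < α := lt_of_le_of_lt (by positivity) hα
  obtain ⟨c, hc⟩ := exists_density_le hα0 hn hκ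
    (by positivity : 0 < 4 / Real.pi ^ 2) σ
  have hm (n : ℕ) : Measurable (interpolatedDensity d α κ σ (truncOrder α J) (h n)) := by
    refine Measurable.indicator ?_ (measurableSet_cube.preimage (measurable_const_smul (h n)))
    have := (continuous_taylorPoly α κ (truncOrder α J)).comp
      ((continuous_laplaceSymbol (d := d) (h n)).comp (continuous_const_smul (h n)))
    exact measurable_const.div this.measurable
  -- The maximum with 0 serves the frequencies outside the cube, where the density vanishes and the
  -- bound only has to be nonnegative.
  refine convergesWeaklyToGaussian_of_tendsto_density (dim_add_one_lt hα)
    (fun n ↦ (hm n).aestronglyMeasurable) (c := max c 0) (fun n ↦ ae_of_all _ fun ξ ↦ ?_)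
    (ae_of_all _ fun ξ ↦ ?_) (fun n ↦ ?_)
  · by_cases hξ : h n • ξ ∈ cube d
    · rw [interpolatedDensity, Set.indicator_of_mem (by exact hξ)]
      refine (hc J hJ ‖ξ‖ _ (norm_nonneg ξ) (laplaceSymbol_smul_ge (hpos n) hξ)).trans ?_
      gcongr
      exact le_max_left _ _
    · rw [interpolatedDensity, Set.indicator_of_notMem (by exact hξ), abs_zero]
      positivity
  · have h1 : Tendsto (fun n ↦ σ ^ 2 / taylorPoly α κ (truncOrder α J)
        (laplaceSymbol (h n) (h n • ξ))) atTop
        (𝓝 (σ ^ 2 / taylorPoly α κ (truncOrder α J) (‖ξ‖ ^ 2))) :=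
      tendsto_const_nhds.div (((continuous_taylorPoly _ _ _).tendsto _).comp
        (tendsto_laplaceSymbol_smul hpos hh ξ)) (taylorPoly_pos hα0 hn hκ J (sq_nonneg _)).ne'
    refine h1.congr' ?_
    filter_upwards [eventually_smul_mem_cube hh ξ] with n hξ
    rw [interpolatedDensity, Set.indicator_of_mem (by exact hξ)]
  · convert hX n using 3 with x y
    rw [interpolatedCov_eq hα0 hn hκ σ hJ (hpos n), invFourier_inv_smul (hpos n)]

theorem convergesWeaklyToGaussian_bandLimited (hα : (d : ℝ) / 2 < α) (hn : ∀ m : ℕ, α ≠ m)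
    (hκ : 0 < κ) (σ : ℝ) {Ω : ℕ → Type*} [∀ n, MeasurableSpace (Ω n)]
    {μ : ∀ n, Measure (Ω n)} [∀ n, IsProbabilityMeasure (μ n)] {X : ∀ n, E d → Ω n → ℝ}
    (hX : ∀ J, IsCentredGaussianField (X J) (μ J)
      fun x y ↦ truncatedCov α κ σ (truncOrder α (J + 1)) (x - y)) :
    ConvergesWeaklyToGaussian X μ fun x y ↦ bandLimitedCov α κ σ (x - y) := by
  have hα0 : 0 < α := lt_of_le_of_lt (by positivity) hα
  obtain ⟨c, hc⟩ := exists_density_le hα0 hn hκ one_pos σ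
  refine convergesWeaklyToGaussian_of_tendsto_density (dim_add_one_lt hα)
    (S := fun J ξ ↦ σ ^ 2 / taylorPoly α κ (truncOrder α (J + 1)) (‖ξ‖ ^ 2))
    (fun n ↦ ?_) (c := c) (fun n ↦ ae_of_all _ fun ξ ↦
      hc _ (Nat.le_add_left 1 n) _ _ (norm_nonneg ξ) (one_mul _).le) ?_ hX
  · have := (continuous_taylorPoly α κ (truncOrder α (n + 1))).comp
      ((continuous_norm (E := E d)).pow 2)
    exact (measurable_const.div this.measurable).aestronglyMeasurable
  · have hnull : ∀ᵐ ξ : E d, ξ ∉ Metric.sphere (0 : E d) κ :=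
      measure_eq_zero_iff_ae_notMem.1 (Measure.addHaar_sphere_of_ne_zero _ _ hκ.ne')
    filter_upwards [hnull] with ξ hξ
    rw [mem_sphere_zero_iff_norm] at hξ
    rcases lt_or_gt_of_ne hξ with hlt | hgt
    · rw [Set.indicator_of_mem (by exact hlt.le)]
      exact (tendsto_density_of_lt σ hκ (sq_nonneg _)
        (pow_lt_pow_left₀ hlt (norm_nonneg ξ) two_ne_zero)).comp (tendsto_add_atTop_nat 1)
    · rw [Set.indicator_of_notMem (by exact not_le.2 hgt)]
      exact (tendsto_density_of_gt σ hα0 hn hκ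
        (pow_lt_pow_left₀ hgt hκ.le two_ne_zero)).comp (tendsto_add_atTop_nat 1)

end Lattice

end GaussField

theorem mainTheorem1 (d : ℕ) :
    -- the general convergence result
    (∀ (Ω : ℕ → Type*) [∀ n, MeasurableSpace (Ω n)] (μ : ∀ n, Measure (Ω n))
        [∀ n, IsProbabilityMeasure (μ n)] (X : ∀ n, GaussField.E d → Ω n → ℝ)
        (Cn S : ℕ → GaussField.E d → ℝ) (C : GaussField.E d → GaussField.E d → ℝ) (c s : ℝ),
      0 < c → ((d : ℝ) + 1) / 2 < s →
      (∀ n, GaussField.IsCentredGaussianField (X n) (μ n) (fun x y ↦ Cn n (x - y))) →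
      (∀ n, GaussField.HasSpectralDensity (Cn n) (S n)) →
      (∀ n, ∀ᵐ ξ : GaussField.E d, |S n ξ| ≤ c / (1 + ‖ξ‖ ^ (2 * s))) →
      (∀ x y, Tendsto (fun n ↦ Cn n (x - y)) atTop (𝓝 (C x y))) →
      GaussField.ConvergesWeaklyToGaussian X μ C) ∧
    -- the applications to approximations of the fractional Matérn field
    (∀ α κ σ : ℝ, (d : ℝ) / 2 < α → (∀ m : ℕ, α ≠ m) → 0 < κ → 0 < σ →
      -- interpolated lattice fields, with fixed truncation order
      (∀ J : ℕ, 1 ≤ J →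
        -- Whittaker–Shannon interpolation of the lattice field and of its covariance function
        (∀ h : ℝ, 0 < h →
          (∀ x : GaussField.E d, Summable fun j : Fin d → ℤ ↦
            GaussField.latticeCov α κ σ (⌊α⌋₊ + 2 * J + 1) h j * GaussField.sincKernel h j x) ∧
          ∀ (Ω : Type*) [MeasurableSpace Ω] (μ : Measure Ω) [IsProbabilityMeasure μ]
            (Z : (Fin d → ℤ) → Ω → ℝ),
            GaussField.IsCentredGaussianField Z μ
              (fun i j ↦ GaussField.latticeCov α κ σ (⌊α⌋₊ + 2 * J + 1) h (i - j)) →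
            (∃ X : GaussField.E d → Ω → ℝ,
              GaussField.IsWhittakerShannonInterpolation h Z X μ) ∧
            ∀ X : GaussField.E d → Ω → ℝ, GaussField.IsWhittakerShannonInterpolation h Z X μ →
              GaussField.IsCentredGaussianField X μ
                (fun x y ↦ GaussField.interpolatedCov α κ σ (⌊α⌋₊ + 2 * J + 1) h (x - y))) ∧
        -- convergence as the lattice step tends to zero
        ∀ (Ω : ℕ → Type*) [∀ n, MeasurableSpace (Ω n)] (μ : ∀ n, Measure (Ω n))
          [∀ n, IsProbabilityMeasure (μ n)] (X : ∀ n, GaussField.E d → Ω n → ℝ) (h : ℕ → ℝ),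
          (∀ n, 0 < h n) → Tendsto h atTop (𝓝 0) →
          (∀ n, GaussField.IsCentredGaussianField (X n) (μ n)
            (fun x y ↦ GaussField.interpolatedCov α κ σ (⌊α⌋₊ + 2 * J + 1) (h n) (x - y))) →
          GaussField.ConvergesWeaklyToGaussian X μ
            (fun x y ↦ GaussField.truncatedCov α κ σ (⌊α⌋₊ + 2 * J + 1) (x - y))) ∧
      -- convergence as the truncation order grows (through `J + 1 = 1, 2, …`)
      ∀ (Ω : ℕ → Type*) [∀ n, MeasurableSpace (Ω n)] (μ : ∀ n, Measure (Ω n))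
        [∀ n, IsProbabilityMeasure (μ n)] (X : ∀ n, GaussField.E d → Ω n → ℝ),
        (∀ J, GaussField.IsCentredGaussianField (X J) (μ J)
          (fun x y ↦ GaussField.truncatedCov α κ σ (⌊α⌋₊ + 2 * (J + 1) + 1) (x - y))) →
        GaussField.ConvergesWeaklyToGaussian X μ
          (fun x y ↦ GaussField.bandLimitedCov α κ σ (x - y))) := by
  refine ⟨fun Ω _ μ _ X Cn S C c s hc hs hX hspec hS hC ↦
    GaussField.convergesWeaklyToGaussian_of_spectralDensity μ X Cn S C hc hs hX hspec hS hC,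
    fun α κ σ hα hn hκ hσ ↦ ?_⟩
  have hα0 : 0 < α := lt_of_le_of_lt (by positivity) hα
  exact ⟨fun J hJ ↦ ⟨fun h hh ↦
    ⟨fun x ↦ (GaussField.hasSum_latticeCov_mul_sincKernel hα0 hn hκ σ hJ hh x).summable,
      fun Ω _ μ _ Z hZ ↦ GaussField.whittakerShannon_interpolation hα0 hn hκ σ hJ hh μ Z hZ⟩,
    fun Ω _ μ _ X h hpos hh hX ↦
      GaussField.convergesWeaklyToGaussian_interpolated hα hn hκ σ hJ hpos hh hX⟩,
    fun Ω _ μ _ X hX ↦ GaussField.convergesWeaklyToGaussian_bandLimited hα hn hκ σ hX⟩
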